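/- Conventions. A hyperoperation on a set $S$ is a map $\boxplus$ from $S\times S$ to the non-empty subsets of $S$; for $A,B\subseteq S$ put $A\boxplus B=\bigcup_{a\in A,b\in B}a\boxplus b$. A hyperfield is a tuple $(F,\odot,\boxplus,1,0)$ such that $(F,\odot,1)$ is a commutative monoid with $0\odot x=0$ for all $x$, $0\neq 1$ and every non-zero element has a multiplicative inverse; $\boxplus$ is commutative and associative; $0\boxplus x=\{x\}$; for each $x$ there is a unique element $-x$ with $0\in x\boxplus(-x)$; $x\in y\boxplus z$ if and only if $z\in x\boxplus(-y)$; and $a\odot(x\boxplus y)=(a\odot x)\boxplus(a\odot y)$. Hypersums of several elements are formed by associativity. Write $F^\times=F\setminus\{0\}$. The support of $X\in F^E$ is $\underline X=\{e\in E: X(e)\ne 0\}$. A strong Grassmann–Plücker function of rank $r$ on $E$ with coefficients in $F$ is a function $\varphi:E^r\to F$ such that (GP1) $\varphi$ is not identically zero; (GP2) $\varphi$ changes by the sign $-1$ when two of its arguments are exchanged, and vanishes when two of its arguments are equal; (GP3) for any two subsets $\{x_1,\dots,x_{r+1}\}$ and $\{y_1,\dots,y_{r-1}\}$ of $E$ (each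 with distinct elements, listed in any order), $$0\in\mathop{\boxplus}_{k=1}^{r+1}(-1)^k\,\varphi(x_1,\dots,\hat x_k,\dots,x_{r+1})\odot\varphi(x_k,y_1,\dots,y_{r-1}).$$ Two such functions are equivalent if $\varphi_1=\alpha\odot\varphi_2$ for some $\alpha\in F^\times$. Let $B_\varphi$ be the collection of all sets $\{x_1,\dots,x_r\}\subseteq E$ with $\varphi(x_1,\dots,x_r)\neq 0$. A strong $F$-matroid $M$ on $E$ is given by a set $\mathcal C\subseteq F^E$, its set of $F$-circuits, such that - (C0) $0\notin\mathcal C$; - (C1) if $X\in\mathcal C$ and $\alpha\in F^\times$, then $\alpha\odot X\in\mathcal C$; - (C2) if $X,Y\in\mathcal C$ and $\underline X\subseteq\underline Y$, then $X=\alpha\odot Y$ for some $\alpha\in F^\times$; - (C3) suppose that $X,X_1,\dots,X_k\in\mathcal C$ form a modular family of size $k+1$, i.e. their supports are distinct and the union of these supports has height $k+1$ in the lattice, ordered by inclusion, of all unions of supports of elements of $\mathcal C$; suppose that $\underline X\not\subseteq\bigcup_{i}\underline{X_i}$, and that $e_i\in(\underline X\cap\underline{X_i})\setminus\bigcup_{j\ne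 i}\underline{X_j}$ satisfies $X(e_i)=-X_i(e_i)\neq 0$ for $1\le i\le k$. Then there is $Z\in\mathcal C$ with $Z(e_i)=0$ for $1\le i\le k$ and $Z(f)\in X(f)\boxplus X_1(f)\boxplus\dots\boxplus X_k(f)$ for every $f\in E$. Here the height of an element $A$ of a lattice is the largest $n$ such that there is a chain $A_0<A_1<\dots<A_n=A$. Theorem. Let $E$ be a non-empty finite set, let $F$ be a hyperfield, and let $r$ be a positive integer. (a) For every strong $F$-matroid $M$ on $E$ there is a unique matroid $\underline M$ on $E$ whose circuits are exactly the supports of the $F$-circuits of $M$. (The rank of $M$ is defined to be the rank of $\underline M$.) (b) There is a bijection from the set of equivalence classes of strong Grassmann–Plücker functions of rank $r$ on $E$ with coefficients in $F$ to the set of strong $F$-matroids of rank $r$ on $E$, which is given explicitly as follows. For every such function $\varphi$, the collection $B_\varphi$ is the set of bases of a matroid $\underline M_\varphi$ of rank $r$ on $E$; this is the underlying matroid of the strong $F$-matroid that corresponds to the class of $\varphi$; and the $F$-circuits of that strong $F$-matroid are exactly the vectors $X\in F^E$ such that $\underline X$ is a circuit of $\underline M_\varphi$ and, whenever $x_0\in\underline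 X$ and $\{x_1,\dots,x_r\}$ is a basis of $\underline M_\varphi$ that contains $\underline X\setminus\{x_0\}$, $$\frac{X(x_i)}{X(x_0)}=(-1)^i\,\frac{\varphi(x_0,\dots,\hat x_i,\dots,x_r)}{\varphi(x_1,\dots,x_r)}\qquad\text{for all }0\le i\le r.$$ -/

import Mathlib

/-- A (commutative) hyperfield. The multiplicative part (commutative monoid with absorbing zero,
`0 ≠ 1`, every nonzero element invertible) is `CommGroupWithZero F`, with the harmless
convention `0⁻¹ = 0`; `hadd` is the multivalued addition and `-x` the hyperinverse of `x`. -/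
class Hyperfield (F : Type*) extends CommGroupWithZero F, Neg F where
  /-- The hypersum of two elements. -/
  hadd : F → F → Set F
  hadd_nonempty : ∀ x y : F, (hadd x y).Nonempty
  hadd_comm : ∀ x y : F, hadd x y = hadd y x
  hadd_assoc : ∀ x y z : F, (⋃ w ∈ hadd y z, hadd x w) = ⋃ w ∈ hadd x y, hadd w z
  zero_hadd : ∀ x : F, hadd 0 x = {x}
  /-- `-x` is the unique element with `0` in the hypersum of `x` and `-x`. -/
  zero_mem_hadd_iff : ∀ x y : F, 0 ∈ hadd x y ↔ y = -x
  /-- Reversibility. -/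
  mem_hadd_iff : ∀ x y z : F, x ∈ hadd y z ↔ z ∈ hadd x (-y)
  mul_hadd : ∀ a x y : F, (fun t => a * t) '' hadd x y = hadd (a * x) (a * y)

/-- The hypersum of a finite list: `x₁ ⊞ ⋯ ⊞ xₘ` is the union of the sets `x₁ ⊞ x'` over
`x' ∈ x₂ ⊞ ⋯ ⊞ xₘ`; the empty hypersum is `{0}`, so that the hypersum of `x` alone is `{x}`. -/
def hsum {F : Type*} [Hyperfield F] : List F → Set F
  | [] => {0}
  | x :: l => ⋃ x' ∈ hsum l, Hyperfield.hadd x x'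

/-! ### Grassmann–Plücker functions -/

/-- The tuple `(a, y₁, …, y_{r-1})` of length `r` (for `r ≥ 1`). -/
def tupleCons {E : Type*} {r : ℕ} (a : E) (y : Fin (r - 1) → E) : Fin r → E :=
  fun i => if h : (i : ℕ) = 0 then a else y ⟨(i : ℕ) - 1, by have := i.isLt; omega⟩

/-- A (strong) Grassmann–Plücker function of rank `r` on `E` with coefficients in `F`. -/
structure GPFunction (F : Type*) [Hyperfield F] (E : Type*) (r : ℕ) where
  /-- The underlying function on `r`-tuples. -/
  toFun : (Fin r → E) → F
  not_identically_zero : ∃ x, toFun x ≠ 0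
  map_swap : ∀ (x : Fin r → E) (i j : Fin r), i ≠ j → toFun (x ∘ Equiv.swap i j) = -toFun x
  map_eq_zero : ∀ (x : Fin r → E) (i j : Fin r), i ≠ j → x i = x j → toFun x = 0
  /-- The Grassmann–Plücker relations, for all sets `{x₁, …, x_{r+1}}` and `{y₁, …, y_{r-1}}`,
  with distinct elements listed in any order. The index `k : Fin (r + 1)` starts from `0`,
  hence the exponent `k + 1`. -/
  grassmann_pluecker : ∀ (x : Fin (r + 1) → E) (y : Fin (r - 1) → E),
    Function.Injective x → Function.Injective y →
      0 ∈ hsum (List.ofFn fun k : Fin (r + 1) =>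
        (-1 : F) ^ ((k : ℕ) + 1) * toFun (x ∘ k.succAbove) * toFun (tupleCons (x k) y))

/-- Two Grassmann–Plücker functions are equivalent if they differ by a nonzero scalar. -/
instance GPFunction.setoid (F : Type*) [Hyperfield F] (E : Type*) (r : ℕ) :
    Setoid (GPFunction F E r) where
  r φ ψ := ∃ α : F, α ≠ 0 ∧ ∀ x, φ.toFun x = α * ψ.toFun x
  iseqv :=
    { refl := fun φ => ⟨1, one_ne_zero, fun x => (one_mul _).symm⟩
      symm := by
        rintro φ ψ ⟨α, hα, h⟩
        exact ⟨α⁻¹, inv_ne_zero hα, fun x => by rw [h x, inv_mul_cancel_left₀ hα]⟩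
      trans := by
        rintro φ ψ χ ⟨α, hα, h⟩ ⟨β, hβ, h'⟩
        exact ⟨α * β, mul_ne_zero hα hβ, fun x => by rw [h x, h' x, mul_assoc]⟩ }

/-- Equivalence classes of Grassmann–Plücker functions of rank `r` on `E` over `F`. -/
abbrev GPClass (F : Type*) [Hyperfield F] (E : Type*) (r : ℕ) : Type _ :=
  Quotient (GPFunction.setoid F E r)

/-- The support `B_φ`: all subsets `{x₁, …, x_r}` of `E` with `φ(x₁, …, x_r) ≠ 0`. -/
def GPFunction.baseSets {F : Type*} [Hyperfield F] {E : Type*} {r : ℕ} (φ : GPFunction F E r) :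
    Set (Set E) :=
  {B | ∃ x : Fin r → E, φ.toFun x ≠ 0 ∧ Set.range x = B}

/-! ### Strong matroids over a hyperfield -/

/-- The set of supports of a set of vectors in `F^E`. -/
def supports {F : Type*} [Hyperfield F] {E : Type*} (C : Set (E → F)) : Set (Set E) :=
  Function.support '' C

/-- The lattice `U(S)` of all unions of subfamilies of `S`, ordered by inclusion. -/
def unionLattice {E : Type*} (S : Set (Set E)) : Set (Set E) :=
  {A | ∃ T ⊆ S, A = ⋃₀ T}

/-- A family of `n` distinct members of `S` is modular (in the lattice of unions of members of
`S`) if its join, that is its union, has height `n` in that lattice. -/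
def IsModularFamily {E : Type*} (S : Set (Set E)) {n : ℕ} (A : Fin n → Set E) : Prop :=
  Function.Injective A ∧ (∀ i, A i ∈ S) ∧
    ∃ h : (⋃ i, A i) ∈ unionLattice S,
      Order.height (⟨⋃ i, A i, h⟩ : unionLattice S) = (n : ℕ∞)

/-- A strong `F`-matroid on `E`, given by its set of `F`-circuits. -/
structure StrongMatroid (F : Type*) [Hyperfield F] (E : Type*) where
  /-- The set of `F`-circuits. -/
  circuits : Set (E → F)
  zero_notMem : (fun _ => 0) ∉ circuits
  smul_mem : ∀ X ∈ circuits, ∀ α : F, α ≠ 0 → (fun e => α * X e) ∈ circuits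
  incomparable : ∀ X ∈ circuits, ∀ Y ∈ circuits, Function.support X ⊆ Function.support Y →
    ∃ α : F, α ≠ 0 ∧ ∀ e, X e = α * Y e
  /-- Strong modular elimination. -/
  elimination : ∀ (k : ℕ) (X : E → F) (Y : Fin k → E → F) (e : Fin k → E),
    X ∈ circuits → (∀ i, Y i ∈ circuits) →
    IsModularFamily (supports circuits)
      (Fin.cons (Function.support X) (fun i => Function.support (Y i)) : Fin (k + 1) → Set E) →
    ¬ Function.support X ⊆ ⋃ i, Function.support (Y i) →
    (∀ i j, j ≠ i → e i ∉ Function.support (Y j)) →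
    (∀ i, X (e i) = -Y i (e i) ∧ X (e i) ≠ 0 ∧ Y i (e i) ≠ 0) →
    ∃ Z ∈ circuits, (∀ i, Z (e i) = 0) ∧
      ∀ f, Z f ∈ hsum (X f :: List.ofFn fun i => Y i f)

/-- `N` is the underlying matroid of `M`: the matroid on all of `E` whose circuits are the
supports of the `F`-circuits of `M`. -/
def StrongMatroid.IsUnderlying {F : Type*} [Hyperfield F] {E : Type*} (M : StrongMatroid F E)
    (N : Matroid E) : Prop :=
  N.E = Set.univ ∧ ∀ A : Set E, N.IsCircuit A ↔ A ∈ supports M.circuits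

/-- `M` has rank `r`: its underlying matroid has rank `r`. -/
def StrongMatroid.HasRank {F : Type*} [Hyperfield F] {E : Type*} (M : StrongMatroid F E)
    (r : ℕ) : Prop :=
  ∃ N : Matroid E, M.IsUnderlying N ∧ N.eRank = (r : ℕ∞)

/-- The vectors attached to `φ` and to a matroid `N` (meant to be the one with set of bases
`B_φ`): the support of `X` is a circuit of `N`, and whenever `x₀ ∈ supp X` and `{x₁, …, x_r}` is
a basis containing `supp X \ {x₀}`, then
`X(x_i) / X(x₀) = (-1)^i φ(x₀, …, x̂_i, …, x_r) / φ(x₁, …, x_r)` for all `i`. -/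
def GPFunction.circuitVectors {F : Type*} [Hyperfield F] {E : Type*} {r : ℕ}
    (φ : GPFunction F E r) (N : Matroid E) : Set (E → F) :=
  {X | N.IsCircuit (Function.support X) ∧
    ∀ x : Fin (r + 1) → E, x 0 ∈ Function.support X →
      N.IsBase (Set.range fun i : Fin r => x i.succ) →
      Function.support X \ {x 0} ⊆ Set.range (fun i : Fin r => x i.succ) →
      ∀ i : Fin (r + 1), X (x i) / X (x 0) =
        (-1 : F) ^ (i : ℕ) * (φ.toFun (x ∘ i.succAbove) / φ.toFun (fun j => x j.succ))}

/-! ### Hyperfield arithmetic -/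

section HyperfieldBasics

variable {F : Type*} [Hyperfield F]

namespace Hyperfield

/-! The proof runs on orthogonality: `Perp X Y` says that `0` lies in the hypersum of the products
`X e * Y e`. A Grassmann–Plücker relation says exactly that `circVec φ x` is orthogonal to `coVec φ
y` (`perp_circVec_coVec_iff`). Once `φ` has an underlying matroid `N`, its F-circuits are the
vectors supported on a circuit of `N` and orthogonal to every `coVec φ y`. A circuit can be met by
such a covector in just two prescribed elements, which fixes the ratio of the two values; so each
circuit carries one vector up to scaling (`GPRepresents.eq_smul_of_perp`), the one given by the
explicit formula (`GPFunction.circuitVectors_eq`).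

From functions to matroids, the point is strong elimination. Height in the lattice of unions of
circuits is nullity (`height_unionLattice`), so in a modular family the union minus the eliminated
elements and one element `f₀` private to `X` is a basis `I` of the union. The eliminated vector
lives on the fundamental circuit of `f₀` over `I`, and orthogonality to a covector meeting `I` only
in `f` gives its hypersum condition at `f` (`GPRepresents.elimination`).

From matroids to functions, modular elimination of pairs already implies ordinary circuit
elimination, which yields the underlying matroid. The circuits prescribe the ratio of `φ` on two
adjacent bases. These ratios come from a function if they are consistent around triangles and
diagonal-free squares of the basis graph (`exists_potential`); only the triangles of bases with a
common subset of corank one need elimination (`div_mul_div`). Running the elimination argument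
backwards then makes every F-circuit orthogonal to every covector (`perp_coVec`), which contains the
Grassmann–Plücker relations. Since the basis graph is connected, the ratios determine `φ` up to a
scalar, and this gives the bijection. -/

lemma zero_mem_hadd_neg (x : F) : 0 ∈ hadd x (-x) := (zero_mem_hadd_iff x (-x)).2 rfl

lemma mul_neg' (a x : F) : a * -x = -(a * x) := by
  rw [← zero_mem_hadd_iff, ← mul_hadd]
  exact ⟨0, zero_mem_hadd_neg x, mul_zero a⟩

instance : HasDistribNeg F where
  neg_neg x := by
    rw [eq_comm, ← zero_mem_hadd_iff, hadd_comm]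
    exact zero_mem_hadd_neg x
  mul_neg := mul_neg'
  neg_mul a b := by rw [mul_comm, mul_neg', mul_comm]

lemma neg_zero' : (-0 : F) = 0 := by
  rw [eq_comm, ← zero_mem_hadd_iff, zero_hadd]
  rfl

lemma neg_eq_zero' {x : F} : -x = 0 ↔ x = 0 := by
  constructor
  · intro h
    rw [← neg_neg x, h, neg_zero']
  · rintro rfl
    exact neg_zero'

lemma neg_one_pow_ne_zero (k : ℕ) : (-1 : F) ^ k ≠ 0 :=
  pow_ne_zero k (by rw [Ne, neg_eq_zero']; exact one_ne_zero)

end Hyperfield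

open Hyperfield

/-- Subsets of a hyperfield, as an additive monoid under hypersums. -/
def HSet (F : Type*) : Type _ := Set F

namespace HSet

instance : Membership F (HSet F) := inferInstanceAs (Membership F (Set F))

omit [Hyperfield F] in
@[ext] lemma ext' {A B : HSet F} (h : ∀ z, z ∈ A ↔ z ∈ B) : A = B := Set.ext h

instance : Add (HSet F) := ⟨fun A B => {z | ∃ a ∈ A, ∃ b ∈ B, z ∈ hadd a b}⟩

/-- The singleton of `a`. -/
def single (a : F) : HSet F := ({a} : Set F)

instance : Zero (HSet F) := ⟨single 0⟩

lemma mem_add {A B : HSet F} {z : F} : z ∈ A + B ↔ ∃ a ∈ A, ∃ b ∈ B, z ∈ hadd a b := Iff.rfl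

omit [Hyperfield F] in
@[simp] lemma mem_single {a z : F} : z ∈ single a ↔ z = a := Iff.rfl

lemma single_zero : single (0 : F) = 0 := rfl

lemma exists_mem_hadd_hadd (x y z t : F) :
    (∃ w ∈ hadd y z, t ∈ hadd x w) ↔ ∃ w ∈ hadd x y, t ∈ hadd w z := by
  have h := Set.ext_iff.1 (hadd_assoc x y z) t
  simpa only [Set.mem_iUnion, exists_prop] using h

instance : AddCommMonoid (HSet F) where
  add_assoc A B C := by
    ext t
    simp only [mem_add]
    constructor
    · rintro ⟨w, ⟨a, ha, b, hb, hw⟩, c, hc, ht⟩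
      obtain ⟨v, hv, ht'⟩ := (exists_mem_hadd_hadd a b c t).2 ⟨w, hw, ht⟩
      exact ⟨a, ha, v, ⟨b, hb, c, hc, hv⟩, ht'⟩
    · rintro ⟨a, ha, w, ⟨b, hb, c, hc, hw⟩, ht⟩
      obtain ⟨v, hv, ht'⟩ := (exists_mem_hadd_hadd a b c t).1 ⟨w, hw, ht⟩
      exact ⟨v, ⟨a, ha, b, hb, hv⟩, c, hc, ht'⟩
  zero_add A := by
    ext t
    rw [mem_add]
    constructor
    · rintro ⟨a, rfl, b, hb, ht⟩
      rw [zero_hadd] at ht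
      rwa [Set.mem_singleton_iff.1 ht]
    · intro ht
      exact ⟨0, rfl, t, ht, by rw [zero_hadd]; rfl⟩
  add_zero A := by
    ext t
    rw [mem_add]
    constructor
    · rintro ⟨b, hb, a, rfl, ht⟩
      rw [hadd_comm, zero_hadd] at ht
      rwa [Set.mem_singleton_iff.1 ht]
    · intro ht
      exact ⟨t, ht, 0, rfl, by rw [hadd_comm, zero_hadd]; rfl⟩
  nsmul := nsmulRec
  add_comm A B := by
    ext t
    simp only [mem_add]
    constructor
    · rintro ⟨a, ha, b, hb, ht⟩
      exact ⟨b, hb, a, ha, by rwa [hadd_comm]⟩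
    · rintro ⟨a, ha, b, hb, ht⟩
      exact ⟨b, hb, a, ha, by rwa [hadd_comm]⟩

lemma mem_hsum_iff {l : List F} {z : F} : z ∈ hsum l ↔ z ∈ (l.map single).sum := by
  induction l generalizing z with
  | nil => exact Iff.rfl
  | cons x l ih =>
    simp only [hsum, Set.mem_iUnion, exists_prop, List.map_cons, List.sum_cons, mem_add,
      mem_single, exists_eq_left, ih]

lemma mem_hsum_ofFn_iff {n : ℕ} {f : Fin n → F} {z : F} :
    z ∈ hsum (List.ofFn f) ↔ z ∈ ∑ i, single (f i) := by
  rw [mem_hsum_iff, List.map_ofFn, List.sum_ofFn]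
  rfl

lemma mem_hsum_cons_ofFn_iff {n : ℕ} {a : F} {f : Fin n → F} {z : F} :
    z ∈ hsum (a :: List.ofFn f) ↔ z ∈ single a + ∑ i, single (f i) := by
  rw [mem_hsum_iff, List.map_cons, List.sum_cons, List.map_ofFn, List.sum_ofFn]
  rfl

/-- Uniqueness of the hyperinverse forces the summand taken from `S` to be `-a`. This is how terms
are moved across a hypersum. -/
lemma zero_mem_single_add {a : F} {S : HSet F} : 0 ∈ single a + S ↔ -a ∈ S := by
  simp only [mem_add, mem_single, exists_eq_left, zero_mem_hadd_iff, exists_eq_right]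

/-- Multiplication by a scalar, as an additive map. -/
def scale (c : F) : HSet F →+ HSet F where
  toFun A := ((fun t => c * t) '' A : Set F)
  map_zero' := by
    change (fun t => c * t) '' ({0} : Set F) = {0}
    simp
  map_add' A B := by
    refine ext' fun z => ?_
    change (∃ t ∈ A + B, c * t = z) ↔ ∃ a ∈ (fun t => c * t) '' (A : Set F),
      ∃ b ∈ (fun t => c * t) '' (B : Set F), z ∈ hadd a b
    constructor
    · rintro ⟨t, ⟨a, ha, b, hb, ht⟩, rfl⟩
      exact ⟨c * a, ⟨a, ha, rfl⟩, c * b, ⟨b, hb, rfl⟩, by rw [← mul_hadd]; exact ⟨t, ht, rfl⟩⟩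
    · rintro ⟨_, ⟨a, ha, rfl⟩, _, ⟨b, hb, rfl⟩, hz⟩
      rw [← mul_hadd] at hz
      obtain ⟨t, ht, rfl⟩ := hz
      exact ⟨t, ⟨a, ha, b, hb, ht⟩, rfl⟩

lemma mem_scale {c z : F} {A : HSet F} : z ∈ scale c A ↔ ∃ t ∈ A, c * t = z := Iff.rfl

lemma mul_mem_scale_iff {c z : F} (hc : c ≠ 0) {A : HSet F} : c * z ∈ scale c A ↔ z ∈ A := by
  rw [mem_scale]
  constructor
  · rintro ⟨t, ht, h⟩
    rwa [← mul_left_cancel₀ hc h]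
  · exact fun h => ⟨z, h, rfl⟩

lemma zero_mem_scale_iff {c : F} (hc : c ≠ 0) {A : HSet F} : 0 ∈ scale c A ↔ 0 ∈ A := by
  simpa only [mul_zero] using mul_mem_scale_iff hc (z := 0) (A := A)

lemma scale_single (c a : F) : scale c (single a) = single (c * a) :=
  Set.image_singleton

lemma scale_sum {ι : Type*} (s : Finset ι) (c : F) (f : ι → F) :
    scale c (∑ i ∈ s, single (f i)) = ∑ i ∈ s, single (c * f i) := by
  rw [map_sum]
  exact Finset.sum_congr rfl fun i _ => scale_single c (f i)

end HSet

open HSet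

/-! ### Orthogonality -/

variable {E : Type*} [Fintype E]

/-- Orthogonality of vectors over a hyperfield. -/
def Perp (X Y : E → F) : Prop := 0 ∈ ∑ e, single (X e * Y e)

lemma sum_single_eq_of_injective {ι : Type*} [Fintype ι] {X : E → F} {f : ι → E}
    (hf : Function.Injective f) (h : ∀ e, e ∉ Set.range f → X e = 0) :
    ∑ e, single (X e) = ∑ i, single (X (f i)) :=
  (Fintype.sum_of_injective f hf _ _ (fun e he => by rw [h e he, single_zero])
    fun _ => rfl).symm

/-- A hypersum of two terms contains `0` only if they are negatives of each other. This turns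
orthogonality into an equation, and every ratio of circuit values is computed this way. -/
lemma Perp.pair {X Y : E → F} (h : Perp X Y) {p q : E} (hpq : p ≠ q)
    (h0 : ∀ e, e ≠ p → e ≠ q → X e * Y e = 0) : X q * Y q = -(X p * Y p) := by
  have hinj : Function.Injective ![p, q] := by
    intro i j
    fin_cases i <;> fin_cases j <;> simp [hpq, hpq.symm]
  unfold Perp at h
  rw [sum_single_eq_of_injective (X := fun e => X e * Y e) hinj
    (fun e he => h0 e (fun h => he ⟨0, h.symm⟩) (fun h => he ⟨1, h.symm⟩)), Fin.sum_univ_two,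
    zero_mem_single_add, mem_single] at h
  exact h.symm

/-- A one-term hypersum is a singleton, so a nonzero term cannot stand alone. Basis exchange comes
from this. -/
lemma Perp.exists_ne {X Y : E → F} (h : Perp X Y) {p : E} (hp : X p * Y p ≠ 0) :
    ∃ q, q ≠ p ∧ X q * Y q ≠ 0 := by
  by_contra! h0
  unfold Perp at h
  rw [Fintype.sum_eq_single p (fun e he => by rw [h0 e he, single_zero]), mem_single] at h
  exact hp h.symm

lemma Perp.smul {X Y : E → F} (h : Perp X Y) {α : F} (hα : α ≠ 0) :
    Perp (fun e => α * X e) Y := by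
  unfold Perp at h ⊢
  rw [← zero_mem_scale_iff hα, scale_sum] at h
  simpa only [mul_assoc] using h

lemma perp_of_mul_eq_zero {X Y : E → F} (h : ∀ e, X e * Y e = 0) : Perp X Y := by
  unfold Perp
  rw [Finset.sum_eq_zero fun e _ => by rw [h e, single_zero]]
  rfl

end HyperfieldBasics

/-! ### Heights in the lattice of unions of circuits -/

section UnionLattice

variable {α : Type*} {S : Set (Set α)} {N : Matroid α}

lemma mem_unionLattice_of_mem {C : Set α} (hC : C ∈ S) : C ∈ unionLattice S :=
  ⟨{C}, Set.singleton_subset_iff.2 hC, (Set.sUnion_singleton C).symm⟩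

lemma union_mem_unionLattice {A B : Set α} (hA : A ∈ unionLattice S) (hB : B ∈ unionLattice S) :
    A ∪ B ∈ unionLattice S := by
  obtain ⟨T, hT, rfl⟩ := hA
  obtain ⟨U, hU, rfl⟩ := hB
  exact ⟨T ∪ U, Set.union_subset hT hU, Set.sUnion_union _ _ |>.symm⟩

lemma empty_mem_unionLattice : ∅ ∈ unionLattice S :=
  ⟨∅, Set.empty_subset _, Set.sUnion_empty.symm⟩

lemma iUnion_mem_unionLattice {ι : Type*} {A : ι → Set α} (hA : ∀ i, A i ∈ S) :
    ⋃ i, A i ∈ unionLattice S :=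
  ⟨Set.range A, Set.range_subset_iff.2 hA, (Set.sUnion_range A).symm⟩

lemma exists_mem_of_mem_unionLattice {A : Set α} (hA : A ∈ unionLattice S) {e : α} (he : e ∈ A) :
    ∃ C ∈ S, C ⊆ A ∧ e ∈ C := by
  obtain ⟨T, hT, rfl⟩ := hA
  obtain ⟨C, hC, heC⟩ := Set.mem_sUnion.1 he
  exact ⟨C, hT hC, Set.subset_sUnion_of_mem hC, heC⟩

/-- Nullity may thus be computed with whichever basis is at hand. -/
lemma Matroid.IsBasis.ncard_sdiff_eq [_root_.Finite α] {I J A : Set α} (hI : N.IsBasis I A)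
    (hJ : N.IsBasis J A) : (A \ I).ncard = (A \ J).ncard := by
  have h : I.ncard = J.ncard := by
    rw [Set.ncard_def, Set.ncard_def, hI.encard_eq_eRk, hJ.encard_eq_eRk]
  rw [Set.ncard_sdiff hI.subset, Set.ncard_sdiff hJ.subset, h]

/-- Add the elements of `J` one at a time, each with its fundamental circuit over `I`. The new
circuit contains the new element, which the earlier union cannot contain, so the chain of unions is
strictly increasing. -/
lemma exists_height_ge [Finite α] (hS : ∀ C, N.IsCircuit C ↔ C ∈ S) {I : Set α}
    (hI : N.Indep I) (J : Set α) (hJ : J ⊆ N.closure I) (hIJ : Disjoint J I) :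
    ∃ A : unionLattice S, A.1 ⊆ I ∪ J ∧ (J.ncard : ℕ∞) ≤ Order.height A := by
  induction J, Set.toFinite J using Set.Finite.induction_on with
  | empty => exact ⟨⟨∅, empty_mem_unionLattice⟩, Set.empty_subset _, by simp⟩
  | @insert a J ha _ ih =>
    rw [Set.insert_subset_iff] at hJ
    rw [Set.disjoint_insert_left] at hIJ
    obtain ⟨A, hA, hle⟩ := ih hJ.2 hIJ.2
    have hC := hI.fundCircuit_isCircuit hJ.1 hIJ.1
    have hCm := mem_unionLattice_of_mem ((hS _).1 hC)
    have haC := N.mem_fundCircuit a I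
    refine ⟨⟨A.1 ∪ N.fundCircuit a I, union_mem_unionLattice A.2 hCm⟩, ?_, ?_⟩
    · refine Set.union_subset (hA.trans ?_) ((N.fundCircuit_subset_insert a I).trans ?_)
      · exact Set.union_subset_union_right _ (Set.subset_insert _ _)
      · exact Set.insert_subset (Or.inr (Set.mem_insert _ _)) Set.subset_union_left
    · rw [Set.ncard_insert_of_notMem ha]
      push_cast
      refine (add_le_add_left hle 1).trans (Order.height_add_one_le ?_)
      refine lt_of_le_of_ne (Set.subset_union_left : A.1 ⊆ _) fun h => ?_
      have : a ∈ A.1 := by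
        rw [h]
        exact Or.inr haC
      exact (hA this).elim hIJ.1 ha

/-- The height of a union of circuits is its nullity. -/
lemma height_unionLattice [Finite α] (hE : N.E = Set.univ) (hS : ∀ C, N.IsCircuit C ↔ C ∈ S)
    (A : unionLattice S) {I : Set α} (hI : N.IsBasis I A.1) :
    Order.height A = ((A.1 \ I).ncard : ℕ∞) := by
  have hsub : ∀ X : Set α, X ⊆ N.E := fun X => by rw [hE]; exact Set.subset_univ X
  choose b hb using fun X : Set α => N.exists_isBasis X (hsub X)
  apply le_antisymm
  -- Nullity increases strictly along inclusions, which bounds height above. An element `e` of `Y`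
  -- outside `X` lies on a circuit inside `Y`, so `Y \ {e}` spans `Y`; a basis of `Y \ {e}`
  -- extending the one of `X` is then a basis of `Y` that omits `e`.
  · have hmono : StrictMono fun X : unionLattice S => (X.1 \ b X.1).ncard := by
      intro X Y hXY
      obtain ⟨e, heY, heX⟩ := Set.exists_of_ssubset (show X.1 ⊂ Y.1 from hXY)
      obtain ⟨C, hCS, hCY, heC⟩ := exists_mem_of_mem_unionLattice Y.2 heY
      have hC := (hS C).2 hCS
      obtain ⟨J, hJ, hXJ⟩ := (hb X.1).exists_isBasis_inter_eq_of_superset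
        (show X.1 ⊆ Y.1 \ {e} from Set.subset_sdiff_singleton hXY.le heX) (hsub _)
      have hJY : N.IsBasis J Y.1 := by
        refine hJ.indep.isBasis_of_subset_of_subset_closure (hJ.subset.trans Set.sdiff_subset) ?_
        rw [hJ.closure_eq_closure]
        intro f hf
        by_cases hfe : f = e
        · subst hfe
          exact N.closure_subset_closure (Set.sdiff_subset_sdiff_left hCY)
            (hC.mem_closure_sdiff_singleton_of_mem heC)
        · exact N.subset_closure _ (hsub _) ⟨hf, hfe⟩
      change (X.1 \ b X.1).ncard < (Y.1 \ b Y.1).ncard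
      rw [(hb Y.1).ncard_sdiff_eq hJY]
      refine Set.ncard_lt_ncard ?_
      refine ⟨fun f hf => ⟨hXY.le hf.1, fun hfJ => hf.2 ?_⟩, fun h => ?_⟩
      · rw [← hXJ]
        exact ⟨hfJ, hf.1⟩
      · exact heX (h ⟨heY, fun heJ => (hJ.subset heJ).2 rfl⟩).1
    refine (Order.height_le_height_apply_of_strictMono _ hmono A).trans ?_
    rw [Order.height_nat, (hb A.1).ncard_sdiff_eq hI]
  · obtain ⟨A', hA', hle⟩ := exists_height_ge hS hI.indep (A.1 \ I)
      (Set.sdiff_subset.trans hI.subset_closure) Set.disjoint_sdiff_left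
    refine hle.trans (Order.height_mono ?_)
    refine show A'.1 ⊆ A.1 from hA'.trans ?_
    exact Set.union_subset hI.subset Set.sdiff_subset

lemma isModularFamily_iff [Finite α] (hE : N.E = Set.univ) (hS : ∀ C, N.IsCircuit C ↔ C ∈ S)
    {n : ℕ} {A : Fin n → Set α} {I : Set α} (hI : N.IsBasis I (⋃ i, A i)) :
    IsModularFamily S A ↔
      Function.Injective A ∧ (∀ i, A i ∈ S) ∧ ((⋃ i, A i) \ I).ncard = n := by
  refine and_congr_right fun _ => and_congr_right fun hA => ?_
  constructor
  · rintro ⟨h, hh⟩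
    rw [height_unionLattice hE hS _ hI] at hh
    exact_mod_cast hh
  · intro h
    refine ⟨iUnion_mem_unionLattice hA, ?_⟩
    rw [height_unionLattice hE hS _ hI]
    exact_mod_cast h

/-! ### Modular elimination implies elimination -/

/-- The union of two distinct members of a clutter that has height at least three contains
properly the union of two other distinct members. -/
lemma exists_pair_of_not_modular (hS0 : ∅ ∉ S) (hanti : ∀ A ∈ S, ∀ B ∈ S, A ⊆ B → A = B)
    {A B : Set α} (hA : A ∈ S) (hB : B ∈ S) (hAB : A ≠ B)
    (hmod : ¬ IsModularFamily S (Fin.cons A fun _ => B : Fin (1 + 1) → Set α)) :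
    ∃ C ∈ S, ∃ D ∈ S, C ≠ D ∧ C ∪ D ⊂ A ∪ B := by
  have hU : (⋃ i, (Fin.cons A fun _ => B : Fin (1 + 1) → Set α) i) = A ∪ B := by
    ext e
    simp
  have hmem : ∀ i, (Fin.cons A fun _ => B : Fin (1 + 1) → Set α) i ∈ S := by
    intro i
    refine Fin.cases hA (fun _ => hB) i
  have hinj : Function.Injective (Fin.cons A fun _ => B : Fin (1 + 1) → Set α) := by
    rw [Fin.cons_injective_iff]
    refine ⟨by simpa using hAB, Function.injective_of_subsingleton _⟩
  have hUm := iUnion_mem_unionLattice hmem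
  have hne : Order.height (⟨_, hUm⟩ : unionLattice S) ≠ ((1 + 1 : ℕ) : ℕ∞) :=
    fun h => hmod ⟨hinj, hmem, hUm, h⟩
  -- The chain from `∅` through `A` to `A ∪ B` gives height at least two; as the pair is not
  -- modular, the height is at least three.
  have h2 : (2 : ℕ∞) ≤ Order.height (⟨_, hUm⟩ : unionLattice S) := by
    have h1 : (⟨∅, empty_mem_unionLattice⟩ : unionLattice S) <
        ⟨A, mem_unionLattice_of_mem hA⟩ := by
      refine lt_of_le_of_ne (Set.empty_subset A) fun h => hS0 ?_
      rw [show ∅ = A from congrArg Subtype.val h]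
      exact hA
    have h2 : (⟨A, mem_unionLattice_of_mem hA⟩ : unionLattice S) < ⟨_, hUm⟩ := by
      refine lt_of_le_of_ne (Set.subset_union_left.trans hU.ge : A ⊆ _) fun h => ?_
      have h' : A = A ∪ B := (congrArg Subtype.val h).trans hU
      exact hAB (hanti B hB A hA (Set.union_eq_left.1 h'.symm)).symm
    calc (2 : ℕ∞) = 0 + 1 + 1 := by norm_num
      _ ≤ _ := (add_le_add_left (add_le_add_left zero_le 1) 1)
      _ ≤ _ := (add_le_add_left (Order.height_add_one_le h1) 1)
      _ ≤ _ := Order.height_add_one_le h2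
  have h3 : ((3 : ℕ) : ℕ∞) ≤ Order.height (⟨_, hUm⟩ : unionLattice S) := by
    have := lt_of_le_of_ne h2 (Ne.symm hne)
    have := Order.add_one_le_of_lt this
    exact le_trans (by norm_num) this
  obtain ⟨p, hp, hlen⟩ := Order.exists_series_of_le_height _ h3
  have hlt : ∀ i j : ℕ, (hi : i < j) → (hj : j ≤ 3) →
      (p ⟨i, by omega⟩).1 ⊂ (p ⟨j, by omega⟩).1 := by
    intro i j hi hj
    exact p.strictMono (show (⟨i, by omega⟩ : Fin (p.length + 1)) < ⟨j, by omega⟩ from hi)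
  have hlast : (p ⟨3, by omega⟩).1 = A ∪ B := by
    rw [← hU, show (⟨3, by omega⟩ : Fin (p.length + 1)) = Fin.last _ from Fin.ext hlen.symm]
    exact congrArg Subtype.val hp
  -- In a chain of length three ending at `A ∪ B`, pick `C` inside the second set and `D` inside the
  -- third with a point outside the second. They differ, and their union stays below the top.
  obtain ⟨a, ha, -⟩ := Set.exists_of_ssubset (hlt 0 1 (by omega) (by omega))
  obtain ⟨C, hC, hCp, -⟩ := exists_mem_of_mem_unionLattice (p _).2 ha
  obtain ⟨b, hb, hb'⟩ := Set.exists_of_ssubset (hlt 1 2 (by omega) (by omega))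
  obtain ⟨D, hD, hDp, hbD⟩ := exists_mem_of_mem_unionLattice (p _).2 hb
  refine ⟨C, hC, D, hD, fun h => hb' (hCp (h ▸ hbD)), ?_⟩
  rw [← hlast]
  exact lt_of_le_of_lt (Set.union_subset (hCp.trans (hlt 1 2 (by omega) (by omega)).subset) hDp)
    (hlt 2 3 (by omega) (by omega))

/-- Induction on the size of `A ∪ B`. If the pair is not modular, some distinct `C`, `D` have a
strictly smaller union. Either one of them already avoids `e`, or both contain `e` and it can be
eliminated from them instead. -/
lemma elimination_of_modular_elimination [Finite α] (hS0 : ∅ ∉ S)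
    (hanti : ∀ A ∈ S, ∀ B ∈ S, A ⊆ B → A = B)
    (hel : ∀ A ∈ S, ∀ B ∈ S, IsModularFamily S (Fin.cons A fun _ => B : Fin (1 + 1) → Set α) →
      ∀ e ∈ A ∩ B, ∃ C ∈ S, C ⊆ (A ∪ B) \ {e})
    {A B : Set α} (hA : A ∈ S) (hB : B ∈ S) (hAB : A ≠ B) {e : α} (he : e ∈ A ∩ B) :
    ∃ C ∈ S, C ⊆ (A ∪ B) \ {e} := by
  induction hn : (A ∪ B).ncard using Nat.strong_induction_on generalizing A B with
  | _ n ih =>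
    by_contra hcon
    have hmod : ¬ IsModularFamily S (Fin.cons A fun _ => B : Fin (1 + 1) → Set α) :=
      fun hmod => hcon (hel A hA B hB hmod e he)
    obtain ⟨C, hC, D, hD, hCD, hlt⟩ := exists_pair_of_not_modular hS0 hanti hA hB hAB hmod
    have hmem : ∀ X ∈ S, X ⊆ A ∪ B → e ∈ X := by
      intro X hX hXU
      by_contra heX
      exact hcon ⟨X, hX, Set.subset_sdiff_singleton hXU heX⟩
    have heC := hmem C hC (Set.subset_union_left.trans hlt.subset)
    have heD := hmem D hD (Set.subset_union_right.trans hlt.subset)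
    obtain ⟨Z, hZ, hZs⟩ := ih _ (by rw [← hn]; exact Set.ncard_lt_ncard hlt) hC hD hCD
      ⟨heC, heD⟩ rfl
    exact hcon ⟨Z, hZ, hZs.trans (Set.sdiff_subset_sdiff_left hlt.subset)⟩

/-- A finite clutter with circuit elimination is the set of circuits of a matroid. -/
lemma exists_matroid_of_elimination [Finite α] (hS0 : ∅ ∉ S)
    (hanti : ∀ A ∈ S, ∀ B ∈ S, A ⊆ B → A = B)
    (hel : ∀ A ∈ S, ∀ B ∈ S, A ≠ B → ∀ e ∈ A ∩ B, ∃ C ∈ S, C ⊆ (A ∪ B) \ {e}) :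
    ∃ N : Matroid α, N.E = Set.univ ∧ ∀ C, N.IsCircuit C ↔ C ∈ S := by
  let Ind : Set α → Prop := fun I => ∀ C ∈ S, ¬ C ⊆ I
  have hmono : ∀ ⦃I J⦄, Ind J → I ⊆ J → Ind I := fun I J hJ hIJ C hC hCI =>
    hJ C hC (hCI.trans hIJ)
  have haug : ∀ ⦃I J⦄, Ind I → Ind J → I.ncard < J.ncard →
      ∃ e ∈ J, e ∉ I ∧ Ind (insert e I) := by
    intro I J hI hJ hlt
    by_contra! hcon
    -- Among the independent subsets of `I ∪ J` larger than `I`, take `K` with `I \ K` as small as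
    -- possible. Since `I` cannot be augmented, some `e ∈ I` is missing from `K`.
    let T : Set (Set α) := {K | Ind K ∧ K ⊆ I ∪ J ∧ I.ncard < K.ncard}
    obtain ⟨K, ⟨hK, hKU, hKc⟩, hmin⟩ := Set.exists_min_image T (fun K => (I \ K).ncard)
      (Set.toFinite T) ⟨J, hJ, Set.subset_union_right, hlt⟩
    have hIK : ¬ I ⊆ K := by
      intro h
      obtain ⟨e, heK, heI⟩ := Set.exists_mem_notMem_of_ncard_lt_ncard hKc
      have heJ := (hKU heK).resolve_left heI
      exact hcon e heJ heI (hmono hK (Set.insert_subset heK h))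
    obtain ⟨e, heI, heK⟩ := Set.not_subset.1 hIK
    -- Trading `f` for `e` would bring `K` closer to `I`, so by minimality the result is dependent,
    -- and the circuit witnessing this must use `e`.
    have hex : ∀ f ∈ K \ I, ∃ C ∈ S, C ⊆ (insert e K) \ {f} ∧ e ∈ C := by
      intro f hf
      have hef : e ≠ f := fun h => hf.2 (h ▸ heI)
      have hnot : (insert e K) \ {f} ∉ T := by
        intro hT
        have := hmin _ hT
        refine absurd (Set.ncard_lt_ncard (s := I \ (insert e K \ {f})) (t := I \ K) ?_)
          (not_lt.2 this)
        refine ⟨fun x hx => ⟨hx.1, fun hxK => hx.2 ⟨Or.inr hxK, ?_⟩⟩, fun h => ?_⟩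
        · rintro rfl
          exact hf.2 hx.1
        · exact (h ⟨heI, heK⟩).2 ⟨Set.mem_insert _ _, hef⟩
      have hdep : ¬ Ind ((insert e K) \ {f}) := by
        intro hi
        refine hnot ⟨hi, ?_, ?_⟩
        · exact Set.sdiff_subset.trans (Set.insert_subset (Or.inl heI) hKU)
        · rw [Set.ncard_sdiff_singleton_of_mem (Set.mem_insert_of_mem _ hf.1),
            Set.ncard_insert_of_notMem heK]
          simpa using hKc
      simp only [Ind, not_forall, not_not] at hdep
      obtain ⟨C, hC, hCs⟩ := hdep
      refine ⟨C, hC, hCs, by_contra fun heC => hK C hC fun x hx => ?_⟩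
      exact (hCs hx).1.resolve_left fun h => heC (h ▸ hx)
    -- Two such circuits: `C`, and `D` chosen to avoid an element `h` of `C`, hence different from
    -- `C`. Eliminating `e` leaves a circuit inside the independent set `K`.
    obtain ⟨g, hgK, hgI⟩ := Set.exists_mem_notMem_of_ncard_lt_ncard hKc
    obtain ⟨C, hC, hCs, heC⟩ := hex g ⟨hgK, hgI⟩
    have hCI := hI C hC
    obtain ⟨h, hhC, hhI⟩ := Set.not_subset.1 hCI
    have hhK : h ∈ K := (hCs hhC).1.resolve_left fun hh => hhI (hh ▸ heI)
    obtain ⟨D, hD, hDs, heD⟩ := hex h ⟨hhK, hhI⟩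
    have hCD : C ≠ D := fun hh => (hDs (hh ▸ hhC)).2 rfl
    obtain ⟨Z, hZ, hZs⟩ := hel C hC D hD hCD e ⟨heC, heD⟩
    refine hK Z hZ fun x hx => ?_
    have hxe : x ≠ e := (hZs hx).2
    rcases (hZs hx).1 with h' | h'
    · exact (hCs h').1.resolve_left hxe
    · exact (hDs h').1.resolve_left hxe
  refine ⟨(IndepMatroid.ofFinite (Set.toFinite Set.univ) Ind
    (fun C hC h => hS0 (Set.subset_empty_iff.1 h ▸ hC)) hmono haug
    (fun I _ => Set.subset_univ I)).matroid, rfl, fun C => ?_⟩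
  rw [Matroid.isCircuit_iff_minimal_not_indep (Set.subset_univ C)]
  change Minimal (fun X => ¬ Ind X) C ↔ C ∈ S
  constructor
  · intro h
    have h1 := h.prop
    simp only [Ind, not_forall, not_not] at h1
    obtain ⟨D, hD, hDC⟩ := h1
    have := h.eq_of_subset (t := D) (fun hi => hi D hD subset_rfl) hDC
    rwa [← this]
  · intro hC
    refine minimal_subset_iff.2 ⟨fun h => h C hC subset_rfl, fun D hD hDC => ?_⟩
    simp only [Ind, not_forall, not_not] at hD
    obtain ⟨X, hX, hXD⟩ := hD
    have := hanti X hX C hC (hXD.trans hDC)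
    exact Set.Subset.antisymm (this ▸ hXD) hDC

end UnionLattice

/-! ### Potentials on the basis graph -/

section Potential

variable {α : Type*} {N : Matroid α}

/-- The set obtained from `B` by exchanging `p` for `q`. -/
def exch (B : Set α) (p q : α) : Set α := insert q (B \ {p})

lemma mem_exch {B : Set α} {p q x : α} : x ∈ exch B p q ↔ x = q ∨ (x ∈ B ∧ x ≠ p) := Iff.rfl

lemma exch_exch_cancel {B : Set α} {p q : α} (hp : p ∈ B) (hq : q ∉ B) :
    exch (exch B p q) q p = B := by
  ext x
  simp only [mem_exch]
  grind

lemma exch_exch_left {B : Set α} {p q s : α} (hq : q ∉ B) :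
    exch (exch B p q) q s = exch B p s := by
  ext x
  simp only [mem_exch]
  grind

lemma exch_exch_right {B : Set α} {p q s : α} (hp : p ∈ B) (hsq : s ≠ q) (hsp : s ≠ p) :
    exch (exch B p q) s p = exch B s q := by
  ext x
  simp only [mem_exch]
  grind

lemma exch_exch_comm {B : Set α} {p p' q q' : α} (h : p ≠ q') (h' : p' ≠ q) :
    exch (exch B p q) p' q' = exch (exch B p' q') p q := by
  ext x
  simp only [mem_exch]
  grind

lemma Matroid.IsCircuit.isBase_exch {C B : Set α} {p q : α} (hC : N.IsCircuit C)
    (hB : N.IsBase B) (hCB : C ⊆ insert q B) (hp : p ∈ C) (hpq : p ≠ q) :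
    N.IsBase (exch B p q) := by
  have hq : q ∉ B := by
    intro hq
    rw [Set.insert_eq_of_mem hq] at hCB
    exact hC.not_indep (hB.indep.subset hCB)
  have hqC : q ∈ C := by
    by_contra hqC
    exact hC.not_indep (hB.indep.subset ((Set.subset_insert_iff_of_notMem hqC).1 hCB))
  have hpB : p ∈ B := (hCB hp).resolve_left hpq
  refine hB.exchange_isBase_of_indep hq ?_
  have hcl : q ∈ N.closure B := by
    rw [hB.closure_eq]
    exact hC.subset_ground hqC
  have := (hB.indep.mem_fundCircuit_iff (x := p) hcl hq).1
    (by rwa [← hC.eq_fundCircuit_of_subset hB.indep hCB])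
  rwa [Set.insert_sdiff_singleton_comm (Ne.symm hpq)]

lemma exists_isCircuit_of_isBase_exch {B : Set α} {p q : α} (hB : N.IsBase B) (hp : p ∈ B)
    (hq : q ∉ B) (h : N.IsBase (exch B p q)) :
    ∃ C, N.IsCircuit C ∧ C ⊆ insert q B ∧ p ∈ C ∧ q ∈ C := by
  have hqE : q ∈ N.E := h.subset_ground (Or.inl rfl)
  have hcl : q ∈ N.closure B := by rwa [hB.closure_eq]
  refine ⟨N.fundCircuit q B, hB.fundCircuit_isCircuit hqE hq, N.fundCircuit_subset_insert q B, ?_,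
    N.mem_fundCircuit q B⟩
  rw [hB.indep.mem_fundCircuit_iff hcl hq]
  have hpq : q ≠ p := fun h => hq (h ▸ hp)
  rw [← Set.insert_sdiff_singleton_comm hpq]
  exact h.indep

lemma Matroid.IsCircuit.mem_of_isBase_exch {C B : Set α} {p q : α} (hC : N.IsCircuit C)
    (hB : N.IsBase B) (hp : p ∈ B) (hq : q ∉ B) (h : N.IsBase (exch B p q))
    (hCB : C ⊆ insert q B) : p ∈ C ∧ q ∈ C := by
  obtain ⟨D, hD, hDB, hpD, hqD⟩ := exists_isCircuit_of_isBase_exch hB hp hq h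
  rw [hC.eq_fundCircuit_of_subset hB.indep hCB, ← hD.eq_fundCircuit_of_subset hB.indep hDB]
  exact ⟨hpD, hqD⟩

/-- As `exch B p q'` is not a base, `p` is not on the fundamental circuit of `q'` over `B`. That
circuit therefore survives the exchange of `p` for `q` and still permits trading `p'` for `q'`. -/
lemma isBase_exch_exch {B : Set α} {p p' q q' : α} (hB : N.IsBase B) (hp' : p' ∈ B)
    (hpp : p ≠ p') (hq' : q' ∉ B)
    (h1 : N.IsBase (exch B p q)) (h2 : N.IsBase (exch B p' q')) (h : ¬ N.IsBase (exch B p q')) :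
    N.IsBase (exch (exch B p q) p' q') := by
  obtain ⟨C, hC, hCB, hpC, hqC⟩ := exists_isCircuit_of_isBase_exch hB hp' hq' h2
  refine hC.isBase_exch h1 ?_ hpC (fun h => hq' (h ▸ hp'))
  intro x hx
  rcases hCB hx with rfl | hxB
  · exact Set.mem_insert _ _
  · refine Or.inr (Or.inr ⟨hxB, ?_⟩)
    rintro rfl
    exact h (hC.isBase_exch hB hCB hx (fun h => hq' (h ▸ hxB)))

-- Written additively to avoid truncated subtraction: one exchange changes the distance `(B \
-- b).ncard` to a fixed base `b` by at most one.
open Classical in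
lemma ncard_exch_sdiff [Finite α] {B b : Set α} {p q : α} (hp : p ∈ B) (hq : q ∉ B) :
    (exch B p q \ b).ncard + (if p ∈ b then 0 else 1) =
      (B \ b).ncard + (if q ∈ b then 0 else 1) := by
  have h1 : ((B \ b) \ {p}).ncard + (if p ∈ b then 0 else 1) = (B \ b).ncard := by
    split_ifs with h
    · rw [Set.sdiff_singleton_eq_self (fun hh => hh.2 h), add_zero]
    · exact Set.ncard_sdiff_singleton_add_one ⟨hp, h⟩
  have h2 : (exch B p q \ b).ncard = ((B \ b) \ {p}).ncard + (if q ∈ b then 0 else 1) := by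
    split_ifs with h
    · rw [add_zero]
      congr 1
      ext x
      simp only [Set.mem_sdiff, mem_exch, Set.mem_singleton_iff]
      grind
    · rw [← Set.ncard_insert_of_notMem (a := q) (fun hh => hq hh.1.1)]
      congr 1
      ext x
      simp only [Set.mem_sdiff, mem_exch, Set.mem_singleton_iff, Set.mem_insert_iff]
      grind
  omega

/-- Edge weights on the basis graph of a matroid with trivial product around triangles and around
squares without diagonals are induced by a potential. -/
lemma exists_potential [Finite α] {G : Type*} [Monoid G]
    (w : Set α → Set α → G)
    (hanti : ∀ B p q, N.IsBase B → p ∈ B → q ∉ B → N.IsBase (exch B p q) →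
      w B (exch B p q) * w (exch B p q) B = 1)
    (hstar : ∀ B p q s, N.IsBase B → p ∈ B → q ∉ B → s ∉ B → q ≠ s →
      N.IsBase (exch B p q) → N.IsBase (exch B p s) →
      w (exch B p q) (exch B p s) * w (exch B p s) B = w (exch B p q) B)
    (htri : ∀ B p s q, N.IsBase B → p ∈ B → s ∈ B → p ≠ s → q ∉ B →
      N.IsBase (exch B p q) → N.IsBase (exch B s q) →
      w (exch B p q) (exch B s q) * w (exch B s q) B = w (exch B p q) B)
    (hsq : ∀ B p p' q q', N.IsBase B → p ∈ B → p' ∈ B → p ≠ p' → q ∉ B → q' ∉ B → q ≠ q' →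
      N.IsBase (exch B p q) → N.IsBase (exch B p' q') → ¬ N.IsBase (exch B p q') →
      ¬ N.IsBase (exch B p' q) → N.IsBase (exch (exch B p q) p' q') →
      w (exch (exch B p q) p' q') (exch B p q) * w (exch B p q) B =
        w (exch (exch B p q) p' q') (exch B p' q') * w (exch B p' q') B) :
    ∃ g : Set α → G, (∀ B, N.IsBase B → IsUnit (g B)) ∧
      ∀ B p q, N.IsBase B → p ∈ B → q ∉ B → N.IsBase (exch B p q) →
        g (exch B p q) = g B * w B (exch B p q) := by
  classical
  obtain ⟨b, hb⟩ := N.exists_isBase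
  -- The potential is built on growing balls around a fixed base `b`. Its values are kept units
  -- because the monoid `G` will be a hyperfield together with its zero.
  suffices h : ∀ n : ℕ, ∃ g : Set α → G,
      (∀ B, N.IsBase B → (B \ b).ncard ≤ n → IsUnit (g B)) ∧
      ∀ B p q, N.IsBase B → p ∈ B → q ∉ B → N.IsBase (exch B p q) →
        (B \ b).ncard ≤ n → (exch B p q \ b).ncard ≤ n →
        g (exch B p q) = g B * w B (exch B p q) by
    obtain ⟨g, hg, hg'⟩ := h (Nat.card α)
    exact ⟨g, fun B hB => hg B hB (Set.ncard_le_card _),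
      fun B p q hB hp hq hB' => hg' B p q hB hp hq hB' (Set.ncard_le_card _)
        (Set.ncard_le_card _)⟩
  intro n
  induction n with
  | zero =>
    refine ⟨fun _ => 1, fun _ _ _ => isUnit_one, fun B p q hB hp hq hB' h1 h2 => ?_⟩
    have hz : ∀ B, N.IsBase B → (B \ b).ncard ≤ 0 → B = b := fun B hB h => by
      refine hB.eq_of_subset_isBase hb ?_
      rw [← Set.sdiff_eq_empty, ← Set.ncard_eq_zero]
      omega
    have : q ∈ B := by
      rw [hz B hB h1, ← hz _ hB' h2]
      exact Or.inl rfl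
    exact absurd this hq
  | succ n ih =>
    obtain ⟨g, hgu, hg⟩ := ih
    have hlow : ∀ B p q, p ∈ B → q ∉ B → p ∉ b → q ∈ b →
        (exch B p q \ b).ncard + 1 = (B \ b).ncard := by
      intro B p q hp hq hpb hqb
      have := ncard_exch_sdiff (b := b) hp hq
      rw [if_neg hpb, if_pos hqb] at this
      exact this
    have hanti' : ∀ B p q, N.IsBase B → p ∈ B → q ∉ B → N.IsBase (exch B p q) →
        w (exch B p q) B * w B (exch B p q) = 1 := by
      intro B p q hB hp hq hB'
      have := hanti (exch B p q) q p hB' (Or.inl rfl)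
        (fun h => h.elim (fun h => hq (h ▸ hp)) fun h => h.2 rfl)
        (by rwa [exch_exch_cancel hp hq])
      rwa [exch_exch_cancel hp hq] at this
    -- A base at distance `n + 1` should receive its value from a neighbour at distance `n`. The
    -- next three claims show that all such neighbours agree: first when the same element is
    -- removed, then when the same element is added, then in general.
    have hcomm1 : ∀ B p q q', N.IsBase B → (B \ b).ncard = n + 1 → p ∈ B → p ∉ b →
        q ∉ B → q ∈ b → q' ∉ B → q' ∈ b → N.IsBase (exch B p q) → N.IsBase (exch B p q') →
        g (exch B p q) * w (exch B p q) B = g (exch B p q') * w (exch B p q') B := by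
      intro B p q q' hB hn hp hpb hq hqb hq' hqb' h1 h2
      by_cases hqq : q = q'
      · rw [hqq]
      have e1 := hlow B p q hp hq hpb hqb
      have e2 := hlow B p q' hp hq' hpb hqb'
      have := hg (exch B p q) q q' h1 (Or.inl rfl)
        (fun h => h.elim (fun h => hqq h.symm) fun h => hq' h.1)
      rw [exch_exch_left hq] at this
      rw [this h2 (by omega) (by omega), mul_assoc, hstar B p q q' hB hp hq hq' hqq h1 h2]
    have hcomm2 : ∀ B p p' q, N.IsBase B → (B \ b).ncard = n + 1 → p ∈ B → p ∉ b →
        p' ∈ B → p' ∉ b → q ∉ B → q ∈ b → N.IsBase (exch B p q) → N.IsBase (exch B p' q) →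
        g (exch B p q) * w (exch B p q) B = g (exch B p' q) * w (exch B p' q) B := by
      intro B p p' q hB hn hp hpb hp' hpb' hq hqb h1 h2
      by_cases hpp : p = p'
      · rw [hpp]
      have e1 := hlow B p q hp hq hpb hqb
      have e2 := hlow B p' q hp' hq hpb' hqb
      have hpq : p ≠ q := fun h => hq (h ▸ hp)
      have := hg (exch B p q) p' p h1 (Or.inr ⟨hp', fun h => hpp h.symm⟩)
        (fun h => h.elim hpq fun h => h.2 rfl)
      rw [exch_exch_right hp (fun h : p' = q => hq (h ▸ hp')) (Ne.symm hpp)] at this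
      rw [this h2 (by omega) (by omega), mul_assoc, htri B p p' q hB hp hp' hpp hq h1 h2]
    have hcomm : ∀ B p p' q q', N.IsBase B → (B \ b).ncard = n + 1 → p ∈ B → p ∉ b →
        p' ∈ B → p' ∉ b → q ∉ B → q ∈ b → q' ∉ B → q' ∈ b →
        N.IsBase (exch B p q) → N.IsBase (exch B p' q') →
        g (exch B p q) * w (exch B p q) B = g (exch B p' q') * w (exch B p' q') B := by
      intro B p p' q q' hB hn hp hpb hp' hpb' hq hqb hq' hqb' h1 h2
      by_cases hpp : p = p'
      · subst hpp
        exact hcomm1 B p q q' hB hn hp hpb hq hqb hq' hqb' h1 h2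
      by_cases hqq : q = q'
      · subst hqq
        exact hcomm2 B p p' q hB hn hp hpb hp' hpb' hq hqb h1 h2
      -- If one of the two mixed exchanges is a base, it links the two neighbours by triangles.
      -- Otherwise the four bases form a square without diagonals, whose far corner lies at distance
      -- `n - 1`, where `g` is already consistent.
      by_cases h3 : N.IsBase (exch B p q')
      · exact (hcomm1 B p q q' hB hn hp hpb hq hqb hq' hqb' h1 h3).trans
          (hcomm2 B p p' q' hB hn hp hpb hp' hpb' hq' hqb' h3 h2)
      by_cases h4 : N.IsBase (exch B p' q)
      · exact (hcomm2 B p p' q hB hn hp hpb hp' hpb' hq hqb h1 h4).trans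
          (hcomm1 B p' q q' hB hn hp' hpb' hq hqb hq' hqb' h4 h2)
      have h5 := isBase_exch_exch hB hp' hpp hq' h1 h2 h3
      have hpq : ∀ x ∈ B, ∀ y, y ∉ B → x ≠ y := fun x hx y hy h => hy (h ▸ hx)
      have hc : exch (exch B p q) p' q' = exch (exch B p' q') p q :=
        exch_exch_comm (hpq p hp q' hq') (hpq p' hp' q hq)
      have m1 : p' ∈ exch B p q := Or.inr ⟨hp', fun h => hpp h.symm⟩
      have m2 : q' ∉ exch B p q := fun h => h.elim (fun h => hqq h.symm) fun h => hq' h.1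
      have m3 : p ∈ exch B p' q' := Or.inr ⟨hp, fun h => hpp h⟩
      have m4 : q ∉ exch B p' q' := fun h => h.elim (fun h => hqq h) fun h => hq h.1
      have e1 := hlow B p q hp hq hpb hqb
      have e2 := hlow B p' q' hp' hq' hpb' hqb'
      have e3 := hlow _ p' q' m1 m2 hpb' hqb'
      have k1 := hg (exch (exch B p q) p' q') q' p' h5 (Or.inl rfl)
        (fun h => h.elim (hpq p' hp' q' hq') fun h => h.2 rfl)
      rw [exch_exch_cancel m1 m2] at k1
      have k2 := hg (exch (exch B p q) p' q') q p h5
        (by rw [hc]; exact Or.inl rfl)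
        (by rw [hc]; exact fun h => h.elim (hpq p hp q hq) fun h => h.2 rfl)
      rw [show exch (exch (exch B p q) p' q') q p = exch B p' q' by
        rw [hc, exch_exch_cancel m3 m4]] at k2
      rw [k1 h1 (by omega) (by omega), k2 h2 (by omega) (by omega), mul_assoc, mul_assoc,
        hsq B p p' q q' hB hp hp' hpp hq hq' hqq h1 h2 h3 h4 h5]
    let P : Set α → α × α → Prop := fun B x =>
      x.1 ∈ B ∧ x.1 ∉ b ∧ x.2 ∉ B ∧ x.2 ∈ b ∧ N.IsBase (exch B x.1 x.2)
    -- The last value `1` is only a default: exchange against `b` gives every base at distance `n +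
    -- 1` a descending neighbour.
    let g' : Set α → G := fun B => if (B \ b).ncard ≤ n then g B else
      if h : ∃ x, P B x then
        g (exch B h.choose.1 h.choose.2) * w (exch B h.choose.1 h.choose.2) B else 1
    have hg'1 : ∀ B, (B \ b).ncard ≤ n → g' B = g B := fun B h => if_pos h
    have hg'2 : ∀ B p q, N.IsBase B → (B \ b).ncard = n + 1 → p ∈ B → p ∉ b → q ∉ B → q ∈ b →
        N.IsBase (exch B p q) → g' B = g (exch B p q) * w (exch B p q) B := by
      intro B p q hB hn hp hpb hq hqb h1
      have hex : ∃ x, P B x := ⟨(p, q), hp, hpb, hq, hqb, h1⟩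
      have : g' B = g (exch B hex.choose.1 hex.choose.2) *
          w (exch B hex.choose.1 hex.choose.2) B := by
        simp only [g']
        rw [if_neg (by omega), dif_pos hex]
      rw [this]
      obtain ⟨c1, c2, c3, c4, c5⟩ := hex.choose_spec
      exact hcomm B _ _ _ _ hB hn c1 c2 hp hpb c3 c4 hq hqb c5 h1
    refine ⟨g', fun B hB hn => ?_, fun B p q hB hp hq hB' h1 h2 => ?_⟩
    · by_cases h : (B \ b).ncard ≤ n
      · rw [hg'1 B h]
        exact hgu B hB h
      · have hn' : (B \ b).ncard = n + 1 := by omega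
        obtain ⟨p, hpB, hpb⟩ : (B \ b).Nonempty := by
          rw [← Set.ncard_pos]
          omega
        obtain ⟨q, ⟨hqb, hqB⟩, hq⟩ := hB.exchange hb ⟨hpB, hpb⟩
        have hq : N.IsBase (exch B p q) := hq
        rw [hg'2 B p q hB hn' hpB hpb hqB hqb hq]
        have e1 := hlow B p q hpB hqB hpb hqb
        refine (hgu _ hq (by omega)).mul ?_
        exact ⟨⟨_, _, hanti' B p q hB hpB hqB hq, hanti B p q hB hpB hqB hq⟩, rfl⟩
    · have hcan := exch_exch_cancel hp hq
      have hpq : p ≠ q := fun h => hq (h ▸ hp)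
      have hpB' : p ∉ exch B p q := fun h => h.elim hpq fun h => h.2 rfl
      have hqB' : q ∈ exch B p q := Or.inl rfl
      have hcard := ncard_exch_sdiff (b := b) hp hq
      by_cases l1 : (B \ b).ncard ≤ n <;> by_cases l2 : (exch B p q \ b).ncard ≤ n
      · rw [hg'1 _ l1, hg'1 _ l2]
        exact hg B p q hB hp hq hB' l1 l2
      · have l2' : (exch B p q \ b).ncard = n + 1 := by omega
        have hqb : q ∉ b := by
          intro hh
          rw [if_pos hh] at hcard
          omega
        have hpb : p ∈ b := by
          by_contra hh
          rw [if_neg hh, if_neg hqb] at hcard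
          omega
        rw [hg'2 _ q p hB' l2' hqB' hqb hpB' hpb (by rwa [hcan]), hcan, hg'1 _ l1]
      · have l1' : (B \ b).ncard = n + 1 := by omega
        have hpb : p ∉ b := by
          intro hh
          rw [if_pos hh] at hcard
          omega
        have hqb : q ∈ b := by
          by_contra hh
          rw [if_neg hh, if_neg hpb] at hcard
          omega
        rw [hg'2 _ p q hB l1' hp hpb hq hqb hB', hg'1 _ l2, mul_assoc,
          hanti' B p q hB hp hq hB', mul_one]
      -- Both ends lie on the new sphere, so `p` and `q` are both in `b` or both outside it. In
      -- either case the two bases have a common descending neighbour, and a triangle compares the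
      -- values.
      · have l1' : (B \ b).ncard = n + 1 := by omega
        have l2' : (exch B p q \ b).ncard = n + 1 := by omega
        by_cases hpb : p ∈ b
        · have hqb : q ∈ b := by
            by_contra hh
            rw [if_neg hh, if_pos hpb] at hcard
            omega
          -- The circuit is not contained in the base `b`, so it has an element `s` outside `b`;
          -- removing `s` from `B` and adding `q` gives the common neighbour.
          obtain ⟨C, hC, hCB, -, hqC⟩ := exists_isCircuit_of_isBase_exch hB hp hq hB'
          obtain ⟨s, hsC, hsb⟩ : ∃ s ∈ C, s ∉ b :=
            Set.not_subset.1 fun h => hC.not_indep (hb.indep.subset h)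
          have hsq : s ≠ q := fun h => hsb (h ▸ hqb)
          have hsp : s ≠ p := fun h => hsb (h ▸ hpb)
          have hsB : s ∈ B := (hCB hsC).resolve_left hsq
          have hsB' : s ∈ exch B p q := Or.inr ⟨hsB, hsp⟩
          have hD := hC.isBase_exch hB hCB hsC hsq
          have hDD : exch (exch B p q) s p = exch B s q := exch_exch_right hp hsq hsp
          have k := htri (exch B p q) s q p hB' hsB' hqB' hsq hpB' (by rwa [hDD]) (by rwa [hcan])
          rw [hDD, hcan] at k
          have := hg'2 (exch B p q) s p hB' l2' hsB' hsb hpB' hpb (by rwa [hDD])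
          rw [hDD] at this
          rw [hg'2 B s q hB l1' hsB hsb hq hqb hD, this, mul_assoc]
          rw [k]
        · have hqb : q ∉ b := by
            intro hh
            rw [if_pos hh, if_neg hpb] at hcard
            omega
          -- Here the common neighbour replaces `p` by an element of `b` instead of by `q`.
          obtain ⟨q', ⟨hqb', hqB'2⟩, hD⟩ := hB.exchange hb ⟨hp, hpb⟩
          have hD : N.IsBase (exch B p q') := hD
          have hqq : q ≠ q' := fun h => hqb (h ▸ hqb')
          have hm : q' ∉ exch B p q := fun h => h.elim (fun h => hqq h.symm) fun h => hqB'2 h.1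
          have hDD : exch (exch B p q) q q' = exch B p q' := exch_exch_left hq
          have := hg'2 (exch B p q) q q' hB' l2' hqB' hqb hm hqb' (by rwa [hDD])
          rw [hDD] at this
          rw [hg'2 B p q' hB l1' hp hpb hqB'2 hqb' hD, this, mul_assoc]
          have k := hstar (exch B p q) q q' p hB' hqB' hm hpB'
            (fun h => hqB'2 (h ▸ hp)) (by rwa [hDD]) (by rwa [hcan])
          rw [hDD, hcan] at k
          rw [k]

end Potential

/-! ### Enumerations and alternating functions -/

section Tuples

variable {E : Type*}

lemma exists_injective_range_eq [Finite E] {B : Set E} {m : ℕ} (h : B.ncard = m) :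
    ∃ x : Fin m → E, Function.Injective x ∧ Set.range x = B := by
  have e : Fin m ≃ B := (Finite.equivFinOfCardEq h).symm
  refine ⟨fun i => e i, Subtype.val_injective.comp e.injective, ?_⟩
  rw [Set.range_comp' Subtype.val e, e.surjective.range_eq, Set.image_univ, Subtype.range_coe]

lemma exists_perm_of_range_eq {r : ℕ} {x x' : Fin r → E} (hx : Function.Injective x)
    (h : Set.range x' = Set.range x) : ∃ σ : Equiv.Perm (Fin r), x' = x ∘ σ := by
  have h1 : ∀ i, ∃ j, x j = x' i := fun i => by
    rw [← Set.mem_range, ← h]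
    exact ⟨i, rfl⟩
  choose s hs using h1
  have hsurj : Function.Surjective s := fun j => by
    obtain ⟨i, hi⟩ : x j ∈ Set.range x' := by
      rw [h]
      exact ⟨j, rfl⟩
    exact ⟨i, hx ((hs i).trans hi)⟩
  exact ⟨Equiv.ofBijective s (Finite.surjective_iff_bijective.1 hsurj),
    funext fun i => (hs i).symm⟩

lemma injective_of_ncard_range {r : ℕ} {x : Fin r → E} (h : (Set.range x).ncard = r) :
    Function.Injective x := by
  rw [← Set.injOn_univ]
  refine Set.injOn_of_ncard_image_eq ?_ (Set.toFinite _)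
  rw [Set.image_univ, h, Set.ncard_univ, Nat.card_eq_fintype_card, Fintype.card_fin]

lemma ncard_range_of_injective {r : ℕ} {x : Fin r → E} (h : Function.Injective x) :
    (Set.range x).ncard = r := by
  rw [← Set.image_univ, Set.ncard_image_of_injective _ h, Set.ncard_univ,
    Nat.card_eq_fintype_card, Fintype.card_fin]

lemma range_comp_succAbove {m : ℕ} {x : Fin (m + 1) → E} (hx : Function.Injective x)
    (k : Fin (m + 1)) : Set.range (x ∘ k.succAbove) = Set.range x \ {x k} := by
  rw [Set.range_comp, Fin.range_succAbove, Set.image_compl_eq_range_sdiff_image hx,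
    Set.image_singleton]

variable {F : Type*} [Hyperfield F]

/-- The function changes sign whenever two of its arguments are exchanged. -/
def IsAlternating {r : ℕ} (φ : (Fin r → E) → F) : Prop :=
  ∀ (x : Fin r → E) (i j : Fin r), i ≠ j → φ (x ∘ Equiv.swap i j) = -φ x

/-- The sign `1` or `-1` as an element of a hyperfield. -/
def unitsSign (F : Type*) [Hyperfield F] : ℤˣ →* F where
  toFun u := if u = 1 then 1 else -1
  map_one' := rfl
  map_mul' u v := by
    rcases Int.units_eq_one_or u with rfl | rfl <;> rcases Int.units_eq_one_or v with rfl | rfl <;>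
      simp

lemma unitsSign_neg (u : ℤˣ) : unitsSign F (-u) = -unitsSign F u := by
  have h : unitsSign F (-1) = -1 := by
    change (if (-1 : ℤˣ) = 1 then (1 : F) else -1) = -1
    rw [if_neg (by decide)]
  rcases Int.units_eq_one_or u with rfl | rfl
  · rw [h, map_one]
  · rw [h, neg_neg, neg_neg, map_one]

lemma unitsSign_mul_self (u : ℤˣ) : unitsSign F u * unitsSign F u = 1 := by
  rw [← map_mul, Int.units_mul_self, map_one]

lemma unitsSign_ne_zero (u : ℤˣ) : unitsSign F u ≠ 0 := fun h =>
  one_ne_zero ((unitsSign_mul_self (F := F) u).symm.trans (by rw [h, mul_zero]))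

lemma IsAlternating.map_perm {r : ℕ} {φ : (Fin r → E) → F} (hφ : IsAlternating φ)
    (σ : Equiv.Perm (Fin r)) (x : Fin r → E) :
    φ (x ∘ σ) = unitsSign F (Equiv.Perm.sign σ) * φ x := by
  induction σ using Equiv.Perm.swap_induction_on generalizing x with
  | one => simp
  | swap_mul σ i j hij ih =>
    rw [show x ∘ (Equiv.swap i j * σ) = (x ∘ Equiv.swap i j) ∘ σ from rfl, ih, hφ x i j hij,
      Equiv.Perm.sign_mul, Equiv.Perm.sign_swap hij, neg_one_mul, unitsSign_neg, mul_neg, neg_mul]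

lemma IsAlternating.ne_zero_of_range_eq {r : ℕ} {φ : (Fin r → E) → F} (hφ : IsAlternating φ)
    {x x' : Fin r → E} (hx : Function.Injective x) (h : Set.range x' = Set.range x)
    (h0 : φ x ≠ 0) : φ x' ≠ 0 := by
  obtain ⟨σ, rfl⟩ := exists_perm_of_range_eq hx h
  rw [hφ.map_perm]
  exact mul_ne_zero (unitsSign_ne_zero _) h0

/-! ### Circuit and cocircuit vectors of a Grassmann–Plücker function -/

/-- The vector `e ↦ φ (e, y)`. -/
def coVec {n : ℕ} (φ : (Fin (n + 1) → E) → F) (y : Fin n → E) (e : E) : F := φ (Fin.cons e y)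

/-- The vector supported on the entries of `x` with values `(-1)^k φ(x₀, …, x̂_k, …)`. -/
noncomputable def circVec {n : ℕ} (φ : (Fin (n + 1) → E) → F) (x : Fin (n + 1 + 1) → E) : E → F :=
  Function.extend x (fun k => (-1) ^ (k : ℕ) * φ (x ∘ k.succAbove)) 0

lemma circVec_apply {n : ℕ} (φ : (Fin (n + 1) → E) → F) {x : Fin (n + 1 + 1) → E}
    (hx : Function.Injective x) (k : Fin (n + 1 + 1)) :
    circVec φ x (x k) = (-1) ^ (k : ℕ) * φ (x ∘ k.succAbove) :=
  hx.extend_apply _ _ k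

lemma circVec_of_notMem {n : ℕ} (φ : (Fin (n + 1) → E) → F) {x : Fin (n + 1 + 1) → E} {e : E}
    (he : e ∉ Set.range x) : circVec φ x e = 0 :=
  Function.extend_apply' _ _ _ he

lemma tupleCons_eq_cons {n : ℕ} (a : E) (y : Fin n → E) :
    (tupleCons (r := n + 1) a y) = (Fin.cons a y : Fin (n + 1) → E) := by
  funext i
  refine Fin.cases ?_ (fun j => ?_) i
  · simp [tupleCons]
  · simp [tupleCons]

-- Both conditions concern the same terms up to an overall factor `-1`: the relation has exponent `k
-- + 1` where `circVec` has `k`.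
open HSet Hyperfield in
lemma perp_circVec_coVec_iff [Fintype E] {n : ℕ} (φ : (Fin (n + 1) → E) → F)
    {x : Fin (n + 1 + 1) → E} (hx : Function.Injective x) (y : Fin n → E) :
    0 ∈ hsum (List.ofFn fun k : Fin (n + 1 + 1) =>
        (-1 : F) ^ ((k : ℕ) + 1) * φ (x ∘ k.succAbove) * φ (tupleCons (r := n + 1) (x k) y)) ↔
      Perp (circVec φ x) (coVec φ y) := by
  unfold Perp
  rw [sum_single_eq_of_injective (X := fun e => circVec φ x e * coVec φ y e) hx
    (fun e he => by rw [circVec_of_notMem φ he, zero_mul]), mem_hsum_ofFn_iff,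
    ← zero_mem_scale_iff (c := (-1 : F)) (neg_eq_zero'.not.2 one_ne_zero), scale_sum]
  simp only [circVec_apply φ hx, tupleCons_eq_cons, coVec, pow_succ, mul_neg, mul_one, neg_mul,
    neg_neg, one_mul]

/-- The function `φ` is a Grassmann–Plücker function with underlying matroid `N`. -/
structure GPRepresents [Fintype E] {n : ℕ} (φ : (Fin (n + 1) → E) → F) (N : Matroid E) :
    Prop where
  ground_eq : N.E = Set.univ
  isBase_range_iff : ∀ x, N.IsBase (Set.range x) ↔ φ x ≠ 0
  ncard_eq : ∀ B, N.IsBase B → B.ncard = n + 1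
  perp : ∀ x y, Function.Injective x → Perp (circVec φ x) (coVec φ y)

variable [Fintype E] {n : ℕ}

/-- The relations are assumed only for distinct entries of `y`; if two entries coincide, the
covector is zero. -/
lemma GPFunction.perp (φ : GPFunction F E (n + 1)) {x : Fin (n + 1 + 1) → E}
    (hx : Function.Injective x) (y : Fin n → E) :
    Perp (circVec φ.toFun x) (coVec φ.toFun y) := by
  by_cases hy : Function.Injective y
  · exact (perp_circVec_coVec_iff _ hx y).1 (φ.grassmann_pluecker x y hx hy)
  · rw [Function.not_injective_iff] at hy
    obtain ⟨i, j, hij, hne⟩ := hy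
    refine perp_of_mul_eq_zero fun e => ?_
    rw [coVec, φ.map_eq_zero _ i.succ j.succ (by simpa using hne) (by simpa using hij), mul_zero]

omit [Fintype E] in
lemma GPFunction.injective_of_ne_zero {r : ℕ} (φ : GPFunction F E r) {x : Fin r → E}
    (h : φ.toFun x ≠ 0) : Function.Injective x := by
  intro i j hij
  by_contra hne
  exact h (φ.map_eq_zero x i j hne hij)

/-- Take the relation between the tuple `(x i, z)` and an enumeration `y` of the first base without
`x i`. Its term at `x i` is nonzero, so another term is nonzero too, and its index is the element to
exchange in. -/
lemma GPFunction.exchangeProperty (φ : GPFunction F E (n + 1)) :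
    Matroid.ExchangeProperty (fun B => B ∈ φ.baseSets) := by
  rintro _ _ ⟨x, hx, rfl⟩ ⟨z, hz, rfl⟩ a ⟨⟨i, rfl⟩, ha⟩
  have hxi := φ.injective_of_ne_zero hx
  have hzi := φ.injective_of_ne_zero hz
  have hcard : (Set.range x \ {x i}).ncard = n := by
    rw [Set.ncard_sdiff_singleton_of_mem (Set.mem_range_self i), ncard_range_of_injective hxi]
    rfl
  obtain ⟨y, hy, hyr⟩ := exists_injective_range_eq hcard
  have hinj : Function.Injective (Fin.cons (x i) z : Fin (n + 1 + 1) → E) :=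
    Fin.cons_injective_iff.2 ⟨ha, hzi⟩
  have h0 : coVec φ.toFun y (x i) ≠ 0 := by
    refine IsAlternating.ne_zero_of_range_eq φ.map_swap hxi ?_ hx
    rw [Fin.range_cons, hyr, Set.insert_sdiff_singleton, Set.insert_eq_of_mem (Set.mem_range_self i)]
  have h1 : circVec φ.toFun (Fin.cons (x i) z) (x i) ≠ 0 := by
    have := circVec_apply φ.toFun hinj 0
    rw [Fin.cons_zero] at this
    rw [this]
    refine mul_ne_zero (Hyperfield.neg_one_pow_ne_zero _) ?_
    exact hz
  obtain ⟨b, hb, hne⟩ := (φ.perp hinj y).exists_ne (mul_ne_zero h1 h0)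
  have hbr : b ∈ Set.range (Fin.cons (x i) z : Fin (n + 1 + 1) → E) := by
    by_contra hbr
    exact hne (by rw [circVec_of_notMem _ hbr, zero_mul])
  rw [Fin.range_cons] at hbr
  have hbz := hbr.resolve_left hb
  have hby : φ.toFun (Fin.cons b y) ≠ 0 := right_ne_zero_of_mul hne
  have hbry := (Fin.cons_injective_iff.1 (φ.injective_of_ne_zero hby)).1
  refine ⟨b, ⟨hbz, fun hbx => hbry ?_⟩, Fin.cons b y, hby, ?_⟩
  · rw [hyr]
    exact ⟨hbx, hb⟩
  · rw [Fin.range_cons, hyr]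

lemma GPFunction.exists_matroid (φ : GPFunction F E (n + 1)) :
    ∃ N : Matroid E, GPRepresents φ.toFun N ∧ ∀ B, N.IsBase B ↔ B ∈ φ.baseSets := by
  obtain ⟨x₀, hx₀⟩ := φ.not_identically_zero
  refine ⟨Matroid.ofIsBaseOfFinite (Set.toFinite Set.univ) (fun B => B ∈ φ.baseSets)
    ⟨_, x₀, hx₀, rfl⟩ φ.exchangeProperty (fun B _ => Set.subset_univ B),
    ⟨rfl, fun x => ?_, fun B hB => ?_, fun x y hx => φ.perp hx y⟩, fun B => Iff.rfl⟩
  · constructor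
    · rintro ⟨x', hx', h⟩
      exact IsAlternating.ne_zero_of_range_eq φ.map_swap (φ.injective_of_ne_zero hx') h.symm hx'
    · exact fun h => ⟨x, h, rfl⟩
  · obtain ⟨x, hx, rfl⟩ := hB
    exact ncard_range_of_injective (φ.injective_of_ne_zero hx)

/-! ### Circuit vectors as vectors orthogonal to the covectors -/

namespace GPRepresents

variable {φ : (Fin (n + 1) → E) → F} {N : Matroid E}

/-- The support is thus a cocircuit, the complement of the hyperplane spanned by `y`, when `y` is
independent with distinct entries; otherwise it is empty. -/
lemma coVec_ne_zero_iff (h : GPRepresents φ N) {y : Fin n → E} {e : E} :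
    coVec φ y e ≠ 0 ↔ N.IsBase (insert e (Set.range y)) := by
  rw [coVec, ← h.isBase_range_iff, Fin.range_cons]

lemma coVec_eq_zero_of_mem (h : GPRepresents φ N) {y : Fin n → E} {e : E}
    (he : e ∈ Set.range y) : coVec φ y e = 0 := by
  by_contra h0
  have hB := h.coVec_ne_zero_iff.1 h0
  rw [Set.insert_eq_of_mem he] at hB
  have h1 := h.ncard_eq _ hB
  have h2 := Set.ncard_image_le (f := y) (s := Set.univ) (Set.toFinite _)
  rw [Set.image_univ, Set.ncard_univ, Nat.card_eq_fintype_card, Fintype.card_fin] at h2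
  omega

lemma exists_range_eq (h : GPRepresents φ N) {B : Set E} (hB : N.IsBase B) {e : E} (he : e ∈ B) :
    ∃ y : Fin n → E, Set.range y = B \ {e} := by
  have hcard : (B \ {e}).ncard = n := by
    rw [Set.ncard_sdiff_singleton_of_mem he, h.ncard_eq B hB]
    rfl
  obtain ⟨y, -, hy⟩ := exists_injective_range_eq hcard
  exact ⟨y, hy⟩

/-- Fix `a` on the circuit and extend the rest of the circuit to a base `B`. For another element
`e`, the covector of `B \ {e}` can be nonzero on the circuit only at `a` and `e`, so orthogonality
determines the value at `e` from the value at `a`. -/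
lemma eq_smul_of_perp (h : GPRepresents φ N) {X X' : E → F}
    (hC : N.IsCircuit (Function.support X)) (hs : Function.support X' = Function.support X)
    (hX : ∀ y, Perp X (coVec φ y)) (hX' : ∀ y, Perp X' (coVec φ y)) :
    ∃ α : F, α ≠ 0 ∧ ∀ e, X e = α * X' e := by
  obtain ⟨a, ha⟩ := hC.nonempty
  have ha' : a ∈ Function.support X' := hs ▸ ha
  refine ⟨X a / X' a, div_ne_zero ha ha', fun e => ?_⟩
  by_cases he : e ∈ Function.support X
  swap
  · rw [Function.notMem_support.1 he, Function.notMem_support.1 (show e ∉ Function.support X' by rwa [hs]), mul_zero]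
  by_cases hea : e = a
  · rw [hea, div_mul_cancel₀ _ ha']
  obtain ⟨B, hB, hCB⟩ := (hC.sdiff_singleton_indep ha).exists_isBase_superset
  have heB : e ∈ B := hCB ⟨he, hea⟩
  obtain ⟨y, hy⟩ := h.exists_range_eq hB heB
  have hey : coVec φ y e ≠ 0 := by
    rw [h.coVec_ne_zero_iff, hy, Set.insert_sdiff_singleton, Set.insert_eq_of_mem heB]
    exact hB
  have key : ∀ Z : E → F, Function.support Z = Function.support X →
      (∀ y, Perp Z (coVec φ y)) → Z e * coVec φ y e = -(Z a * coVec φ y a) := by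
    intro Z hZ hperp
    refine (hperp y).pair (Ne.symm hea) fun f hfa hfe => ?_
    by_cases hf : f ∈ Function.support X
    · rw [h.coVec_eq_zero_of_mem, mul_zero]
      rw [hy]
      exact ⟨hCB ⟨hf, hfa⟩, hfe⟩
    · rw [Function.notMem_support.1 (show f ∉ Function.support Z by rwa [hZ]), zero_mul]
  have k1 := key X rfl hX
  have k2 := key X' hs hX'
  apply mul_right_cancel₀ hey
  rw [k1, mul_assoc, k2, mul_neg, ← mul_assoc, div_mul_cancel₀ _ ha']

/-- The value at `x k` is nonzero exactly when deleting `x k` leaves a base, that is, when `x k`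
lies on the fundamental circuit of `x 0`. -/
lemma support_circVec (h : GPRepresents φ N) {C : Set E} (hC : N.IsCircuit C)
    {x : Fin (n + 1 + 1) → E} (hx : Function.Injective x)
    (hB : N.IsBase (Set.range fun i : Fin (n + 1) => x i.succ)) (hCx : C ⊆ Set.range x) :
    Function.support (circVec φ x) = C := by
  have hr : Set.range x = insert (x 0) (Set.range fun i : Fin (n + 1) => x i.succ) := by
    conv_lhs => rw [← Fin.cons_self_tail x, Fin.range_cons]
    rfl
  have h0 : x 0 ∉ Set.range fun i : Fin (n + 1) => x i.succ := by
    rintro ⟨i, hi⟩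
    exact Fin.succ_ne_zero i (hx hi)
  ext e
  by_cases he : e ∈ Set.range x
  swap
  · exact iff_of_false (fun hh => hh (circVec_of_notMem φ he)) fun heC => he (hCx heC)
  obtain ⟨k, rfl⟩ := he
  rw [Function.mem_support, circVec_apply φ hx]
  have : (-1 : F) ^ (k : ℕ) * φ (x ∘ k.succAbove) ≠ 0 ↔ φ (x ∘ k.succAbove) ≠ 0 :=
    ⟨right_ne_zero_of_mul, mul_ne_zero (Hyperfield.neg_one_pow_ne_zero _)⟩
  rw [this, ← h.isBase_range_iff]
  by_cases hk : k = 0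
  · subst hk
    refine iff_of_true (by simpa [Function.comp_def] using hB) ?_
    by_contra h0C
    rw [hr] at hCx
    exact hC.not_indep (hB.indep.subset ((Set.subset_insert_iff_of_notMem h0C).1 hCx))
  · have hk0 : x k ≠ x 0 := fun hh => hk (hx hh)
    have hkB : x k ∈ Set.range fun i : Fin (n + 1) => x i.succ := by
      have : x k ∈ Set.range x := ⟨k, rfl⟩
      rw [hr] at this
      exact this.resolve_left hk0
    rw [range_comp_succAbove hx, hr, ← Set.insert_sdiff_singleton_comm hk0.symm]
    exact ⟨fun hh => (hC.mem_of_isBase_exch hB hkB h0 hh (hr ▸ hCx)).1,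
      fun hh => hC.isBase_exch hB (hr ▸ hCx) hh hk0⟩

lemma exists_tuple (h : GPRepresents φ N) {C : Set E} (hC : N.IsCircuit C) :
    ∃ x : Fin (n + 1 + 1) → E, Function.Injective x ∧ x 0 ∈ C ∧
      N.IsBase (Set.range fun i : Fin (n + 1) => x i.succ) ∧
      C \ {x 0} ⊆ (Set.range fun i : Fin (n + 1) => x i.succ) ∧ C ⊆ Set.range x := by
  obtain ⟨a, ha⟩ := hC.nonempty
  obtain ⟨B, hB, hCB⟩ := (hC.sdiff_singleton_indep ha).exists_isBase_superset
  obtain ⟨z, hz, rfl⟩ := exists_injective_range_eq (h.ncard_eq B hB)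
  have haz : a ∉ Set.range z := fun haB => hC.not_indep (hB.indep.subset fun e he => by
    by_cases hea : e = a
    · exact hea ▸ haB
    · exact hCB ⟨he, hea⟩)
  refine ⟨Fin.cons a z, Fin.cons_injective_iff.2 ⟨haz, hz⟩, ha, hB, hCB, fun e he => ?_⟩
  rw [Fin.range_cons]
  by_cases hea : e = a
  · exact Or.inl hea
  · exact Or.inr (hCB ⟨he, hea⟩)

lemma exists_perp (h : GPRepresents φ N) {C : Set E} (hC : N.IsCircuit C) :
    ∃ X : E → F, Function.support X = C ∧ ∀ y, Perp X (coVec φ y) := by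
  obtain ⟨x, hx, -, hB, -, hCx⟩ := h.exists_tuple hC
  exact ⟨circVec φ x, h.support_circVec hC hx hB hCx, fun y => h.perp x y hx⟩

/-- Vectors supported on a circuit and orthogonal to all vectors `e ↦ φ (e, y)`. -/
def vectors (φ : (Fin (n + 1) → E) → F) (N : Matroid E) : Set (E → F) :=
  {X | N.IsCircuit (Function.support X) ∧ ∀ y, Perp X (coVec φ y)}

lemma isCircuit_iff (h : GPRepresents φ N) (C : Set E) :
    N.IsCircuit C ↔ C ∈ supports (vectors φ N) := by
  constructor
  · intro hC
    obtain ⟨X, rfl, hX⟩ := h.exists_perp hC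
    exact ⟨X, ⟨hC, hX⟩, rfl⟩
  · rintro ⟨X, hX, rfl⟩
    exact hX.1

end GPRepresents

/-- The ratio formula says that `X` is a multiple of `circVec` of the tuple. One tuple suffices to
deduce orthogonality; conversely, uniqueness up to scaling gives the formula for every admissible
tuple, whose entries are automatically distinct. -/
lemma GPFunction.circuitVectors_eq (φ : GPFunction F E (n + 1)) {N : Matroid E}
    (h : GPRepresents φ.toFun N) : φ.circuitVectors N = GPRepresents.vectors φ.toFun N := by
  ext X
  refine and_congr_right fun hC => ⟨fun hX y => ?_, fun hX x h0 hB hsub i => ?_⟩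
  · obtain ⟨x, hx, h0, hB, hsub, hCx⟩ := h.exists_tuple hC
    have hB0 : φ.toFun (fun j => x j.succ) ≠ 0 := (h.isBase_range_iff _).1 hB
    have : X = fun e => (X (x 0) / φ.toFun (fun j => x j.succ)) * circVec φ.toFun x e := by
      funext e
      by_cases he : e ∈ Set.range x
      · obtain ⟨i, rfl⟩ := he
        have := hX x h0 hB hsub i
        rw [div_eq_iff h0] at this
        rw [circVec_apply _ hx, this]
        simp only [div_eq_mul_inv]
        ac_rfl
      · rw [circVec_of_notMem _ he, mul_zero]
        by_contra hne
        exact he (hCx hne)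
    rw [this]
    exact (h.perp x y hx).smul (div_ne_zero h0 hB0)
  · have hxt := injective_of_ncard_range (h.ncard_eq _ hB)
    have hsub' : Function.support X ⊆
        insert (x 0) (Set.range fun i : Fin (n + 1) => x i.succ) := by
      rwa [← Set.sdiff_singleton_subset_iff]
    have hnot : x 0 ∉ Set.range fun i : Fin (n + 1) => x i.succ := by
      intro hmem
      rw [Set.insert_eq_of_mem hmem] at hsub'
      exact hC.not_indep (hB.indep.subset hsub')
    have hx : Function.Injective x := by
      rw [← Fin.cons_self_tail x]
      exact Fin.cons_injective_iff.2 ⟨hnot, hxt⟩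
    have hCx : Function.support X ⊆ Set.range x := by
      rw [← Fin.cons_self_tail x, Fin.range_cons]
      exact hsub'
    obtain ⟨α, hα, hXα⟩ := h.eq_smul_of_perp hC (h.support_circVec hC hx hB hCx) hX
      (fun y => h.perp x y hx)
    have h00 := circVec_apply φ.toFun hx 0
    rw [Fin.val_zero, pow_zero, one_mul] at h00
    rw [hXα, hXα, h00, circVec_apply _ hx, mul_div_mul_left _ _ hα, mul_div_assoc]
    rfl

end Tuples

/-! ### The strong matroid of a Grassmann–Plücker function -/

section Elimination

variable {E : Type*} [Fintype E] {F : Type*} [Hyperfield F] {n : ℕ}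
  {φ : (Fin (n + 1) → E) → F} {N : Matroid E}

omit [Fintype E] in
lemma iUnion_cons_support {k : ℕ} {X : E → F} {Y : Fin k → E → F} {f : E} :
    f ∈ (⋃ i, (Fin.cons (Function.support X) (fun i => Function.support (Y i)) :
      Fin (k + 1) → Set E) i) ↔ X f ≠ 0 ∨ ∃ i, Y i f ≠ 0 := by
  rw [Set.mem_iUnion, Fin.exists_fin_succ]
  rfl

/-- In a modular family as in strong modular elimination, deleting the elements to be eliminated
and an element `f₀` of the first circuit only leaves a basis of the union. -/
lemma isBasis_of_isModularFamily (hE : N.E = Set.univ) {S : Set (Set E)}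
    (hS : ∀ C, N.IsCircuit C ↔ C ∈ S) {k : ℕ} {X : E → F} {Y : Fin k → E → F} {e : Fin k → E}
    {U : Set E} (hU : U = ⋃ i, (Fin.cons (Function.support X) (fun i => Function.support (Y i)) :
      Fin (k + 1) → Set E) i)
    (hmod : IsModularFamily S
      (Fin.cons (Function.support X) (fun i => Function.support (Y i)) : Fin (k + 1) → Set E))
    {f₀ : E} (hf₀ : X f₀ ≠ 0) (hf₀Y : ∀ i, Y i f₀ = 0)
    (heY : ∀ i j, j ≠ i → Y j (e i) = 0) (he : ∀ i, Y i (e i) ≠ 0) :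
    N.IsBasis (U \ insert f₀ (Set.range e)) U := by
  have hsub : ∀ X : Set E, X ⊆ N.E := fun X => by rw [hE]; exact Set.subset_univ X
  have hmU : ∀ f, f ∈ U ↔ X f ≠ 0 ∨ ∃ i, Y i f ≠ 0 := fun f => by
    rw [hU]
    exact iUnion_cons_support
  have hcX : N.IsCircuit (Function.support X) := (hS _).2 (hmod.2.1 0)
  have hcY : ∀ i, N.IsCircuit (Function.support (Y i)) := fun i => (hS _).2 (hmod.2.1 i.succ)
  have heinj : Function.Injective e := fun i j hij => by
    by_contra hne
    exact he j (hij ▸ heY i j (Ne.symm hne))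
  have hf₀e : f₀ ∉ Set.range e := by
    rintro ⟨i, rfl⟩
    exact he i (hf₀Y i)
  have hJU : insert f₀ (Set.range e) ⊆ U := by
    rintro f (rfl | ⟨i, rfl⟩)
    · exact (hmU _).2 (Or.inl hf₀)
    · exact (hmU _).2 (Or.inr ⟨i, he i⟩)
  have hJcard : (insert f₀ (Set.range e)).ncard = k + 1 := by
    rw [Set.ncard_insert_of_notMem hf₀e, ncard_range_of_injective heinj]
  set I := U \ insert f₀ (Set.range e) with hI
  have hecl : ∀ i, e i ∈ N.closure I := fun i => by
    refine N.closure_subset_closure ?_ ((hcY i).mem_closure_sdiff_singleton_of_mem (he i))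
    rintro g ⟨hg, hge⟩
    refine ⟨(hmU g).2 (Or.inr ⟨i, hg⟩), ?_⟩
    rintro (rfl | ⟨j, rfl⟩)
    · exact hg (hf₀Y i)
    · exact hg (heY j i (fun h => hge (h ▸ rfl)))
  have hIcl : I ⊆ N.closure I := N.subset_closure I (hsub I)
  have hfcl : f₀ ∈ N.closure I := by
    refine N.closure_subset_closure_of_subset_closure ?_
      (hcX.mem_closure_sdiff_singleton_of_mem hf₀)
    rintro g ⟨hg, hgf⟩
    by_cases hge : g ∈ Set.range e
    · obtain ⟨i, rfl⟩ := hge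
      exact hecl i
    · exact hIcl ⟨(hmU g).2 (Or.inl hg), fun h => h.elim hgf hge⟩
  have hUcl : U ⊆ N.closure I := fun g hg => by
    by_cases hgJ : g ∈ insert f₀ (Set.range e)
    · rcases hgJ with rfl | ⟨i, rfl⟩
      · exact hfcl
      · exact hecl i
    · exact hIcl ⟨hg, hgJ⟩
  -- A basis `I'` of the spanning set `I` is a basis of `U`. Modularity makes its complement in `U`
  -- have size `k + 1`, the number of deleted elements, so nothing more was removed and `I' = I`.
  obtain ⟨I', hI'⟩ := N.exists_isBasis I (hsub I)
  have hI'U : N.IsBasis I' U := by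
    refine hI'.indep.isBasis_of_subset_of_subset_closure (hI'.subset.trans Set.sdiff_subset) ?_
    rwa [hI'.closure_eq_closure]
  have hcard := ((isModularFamily_iff hE hS (hU ▸ hI'U)).1 hmod).2.2
  rw [← hU] at hcard
  have hJ : insert f₀ (Set.range e) = U \ I' := by
    refine Set.eq_of_subset_of_ncard_le (fun g hg => ⟨hJU hg, fun hgI => ?_⟩)
      (by rw [hcard, hJcard])
    exact (hI'.subset hgI).2 hg
  have : I = I' := by
    rw [hI, hJ, Set.sdiff_sdiff_cancel_left hI'U.subset]
  rwa [this]

-- Take `Z` on the fundamental circuit of `f₀` over the basis `I` of the union, scaled so that `Z f₀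
-- = X f₀`; it vanishes at every `e i`. At `f ∈ I` use a covector `V` that is zero on the rest of
-- `I`. Orthogonality to `Z` and `Y i` gives `Z f * V f = -(X f₀ * V f₀)` and `Y i f * V f = X (e i)
-- * V (e i)`; substituted into orthogonality to `X` and divided by `V f`, these are the required
-- membership.
open HSet in
lemma GPRepresents.elimination (h : GPRepresents φ N) {k : ℕ} {X : E → F} {Y : Fin k → E → F}
    {e : Fin k → E} (hX : X ∈ GPRepresents.vectors φ N) (hY : ∀ i, Y i ∈ GPRepresents.vectors φ N)
    (hmod : IsModularFamily (supports (GPRepresents.vectors φ N))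
      (Fin.cons (Function.support X) (fun i => Function.support (Y i)) : Fin (k + 1) → Set E))
    (hsub : ¬ Function.support X ⊆ ⋃ i, Function.support (Y i))
    (heY : ∀ i j, j ≠ i → e i ∉ Function.support (Y j))
    (he : ∀ i, X (e i) = -Y i (e i) ∧ X (e i) ≠ 0 ∧ Y i (e i) ≠ 0) :
    ∃ Z ∈ GPRepresents.vectors φ N, (∀ i, Z (e i) = 0) ∧
      ∀ f, Z f ∈ hsum (X f :: List.ofFn fun i => Y i f) := by
  obtain ⟨f₀, hf₀, hf₀Y⟩ := Set.not_subset.1 hsub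
  have hf₀Y : ∀ i, Y i f₀ = 0 := fun i => by
    by_contra hne
    exact hf₀Y (Set.mem_iUnion.2 ⟨i, hne⟩)
  have heY : ∀ i j, j ≠ i → Y j (e i) = 0 := fun i j hij => Function.notMem_support.1 (heY i j hij)
  obtain ⟨U, hU⟩ : ∃ U, U = ⋃ i, (Fin.cons (Function.support X)
    (fun i => Function.support (Y i)) : Fin (k + 1) → Set E) i := ⟨_, rfl⟩
  have hmU : ∀ f, f ∈ U ↔ X f ≠ 0 ∨ ∃ i, Y i f ≠ 0 := fun f => by
    rw [hU]
    exact iUnion_cons_support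
  have hI := isBasis_of_isModularFamily h.ground_eq h.isCircuit_iff hU hmod hf₀ hf₀Y heY
    (fun i => (he i).2.2)
  set I := U \ insert f₀ (Set.range e) with hIdef
  have hf₀U : f₀ ∈ U := (hmU _).2 (Or.inl hf₀)
  have hf₀I : f₀ ∉ I := fun hh => hh.2 (Or.inl rfl)
  have hC := hI.indep.fundCircuit_isCircuit (hI.subset_closure hf₀U) hf₀I
  have hCI := N.fundCircuit_subset_insert f₀ I
  obtain ⟨Z₀, hZ₀, hZ₀p⟩ := h.exists_perp hC
  have hZ₀f : Z₀ f₀ ≠ 0 := by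
    have : f₀ ∈ Function.support Z₀ := by
      rw [hZ₀]
      exact N.mem_fundCircuit f₀ I
    exact this
  have hα : X f₀ / Z₀ f₀ ≠ 0 := div_ne_zero hf₀ hZ₀f
  obtain ⟨Z, hZdef⟩ : ∃ Z : E → F, Z = fun f => X f₀ / Z₀ f₀ * Z₀ f := ⟨_, rfl⟩
  have hZs : Function.support Z = N.fundCircuit f₀ I := by
    rw [← hZ₀]
    ext f
    simp only [hZdef, Function.mem_support, ne_eq, mul_eq_zero, hα, false_or]
  have hZp : ∀ y, Perp Z (coVec φ y) := fun y => hZdef ▸ (hZ₀p y).smul hα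
  have hZf₀ : Z f₀ = X f₀ := by rw [hZdef]; exact div_mul_cancel₀ _ hZ₀f
  have hZI : ∀ f, Z f ≠ 0 → f = f₀ ∨ f ∈ I := fun f hf => hCI (hZs ▸ hf)
  have heI : ∀ i, e i ≠ f₀ := fun i hh => (he i).2.2 (hh ▸ hf₀Y i)
  have hZe : ∀ i, Z (e i) = 0 := fun i => by
    by_contra hne
    exact (hZI _ hne).elim (heI i) fun hh => hh.2 (Or.inr ⟨i, rfl⟩)
  refine ⟨Z, ⟨hZs ▸ hC, hZp⟩, hZe, fun f => ?_⟩
  rw [mem_hsum_cons_ofFn_iff]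
  by_cases hfU : f ∈ U
  swap
  · have hXf : X f = 0 := by
      by_contra hne
      exact hfU ((hmU f).2 (Or.inl hne))
    have hYf : ∀ i, Y i f = 0 := fun i => by
      by_contra hne
      exact hfU ((hmU f).2 (Or.inr ⟨i, hne⟩))
    have hZf : Z f = 0 := by
      by_contra hne
      rcases hZI f hne with rfl | hh
      · exact hfU hf₀U
      · exact hfU hh.1
    simp only [hXf, hYf, hZf, single_zero, Finset.sum_const_zero, add_zero]
    rfl
  by_cases hfJ : f ∈ insert f₀ (Set.range e)
  · rcases hfJ with rfl | ⟨i, rfl⟩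
    · simp only [hf₀Y, single_zero, Finset.sum_const_zero, add_zero, hZf₀, mem_single]
    · rw [hZe, zero_mem_single_add, Finset.sum_eq_single i
        (fun j _ hj => by rw [heY i j hj, single_zero]) (fun hh => absurd (Finset.mem_univ i) hh),
        mem_single, (he i).1, neg_neg]
  have hfI : f ∈ I := ⟨hfU, hfJ⟩
  -- The covector comes from a base containing `I`, with `f` removed.
  obtain ⟨B, hB, hIB⟩ := hI.indep.exists_isBase_superset
  obtain ⟨y, hy⟩ := h.exists_range_eq hB (hIB hfI)
  have hfV : coVec φ y f ≠ 0 := by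
    rw [h.coVec_ne_zero_iff, hy, Set.insert_sdiff_singleton, Set.insert_eq_of_mem (hIB hfI)]
    exact hB
  have hIV : ∀ g ∈ I, g ≠ f → coVec φ y g = 0 := fun g hg hgf => by
    refine h.coVec_eq_zero_of_mem ?_
    rw [hy]
    exact ⟨hIB hg, hgf⟩
  have hff₀ : f ≠ f₀ := fun hh => hfJ (Or.inl hh)
  have hfe : ∀ i, f ≠ e i := fun i hh => hfJ (Or.inr ⟨i, hh.symm⟩)
  have kZ : Z f₀ * coVec φ y f₀ = -(Z f * coVec φ y f) := by
    refine (hZp y).pair hff₀ fun g hgf hgf₀ => ?_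
    by_cases hg : Z g = 0
    · rw [hg, zero_mul]
    · rw [hIV g ((hZI g hg).resolve_left hgf₀) hgf, mul_zero]
  have kY : ∀ i, Y i (e i) * coVec φ y (e i) = -(Y i f * coVec φ y f) := fun i => by
    refine ((hY i).2 y).pair (hfe i) fun g hgf hge => ?_
    by_cases hg : Y i g = 0
    · rw [hg, zero_mul]
    · rw [hIV g ⟨(hmU g).2 (Or.inr ⟨i, hg⟩), ?_⟩ hgf, mul_zero]
      rintro (rfl | ⟨j, rfl⟩)
      · exact hg (hf₀Y i)
      · exact hg (heY j i fun hh => hge (hh ▸ rfl))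
  have heinj : Function.Injective e := fun i j hij => by
    by_contra hne
    exact (he j).2.2 (hij ▸ heY i j (Ne.symm hne))
  have hinj : Function.Injective (Fin.cons f (Fin.cons f₀ e) : Fin (k + 1 + 1) → E) := by
    refine Fin.cons_injective_iff.2 ⟨?_, Fin.cons_injective_iff.2 ⟨?_, heinj⟩⟩
    · rw [Fin.range_cons]
      exact hfJ
    · rintro ⟨i, hi⟩
      exact heI i hi
  have kX := hX.2 y
  unfold Perp at kX
  rw [sum_single_eq_of_injective (X := fun g => X g * coVec φ y g) hinj fun g hg => ?_,
    Fin.sum_univ_succ, Fin.sum_univ_succ, add_left_comm, Fin.cons_succ, Fin.cons_zero,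
    Fin.cons_zero, zero_mem_single_add] at kX
  · simp only [Fin.cons_succ] at kX
    rw [← hZf₀, kZ, neg_neg] at kX
    have hsum : ∀ i, X (e i) * coVec φ y (e i) = Y i f * coVec φ y f := fun i => by
      rw [(he i).1, neg_mul, kY i, neg_neg]
    simp only [hsum] at kX
    rw [← mul_mem_scale_iff hfV, map_add, scale_sum, scale_single]
    simpa only [mul_comm (coVec φ y f)] using kX
  · rw [Fin.range_cons, Fin.range_cons] at hg
    by_cases hXg : X g = 0
    · rw [hXg, zero_mul]
    · rw [hIV g ⟨(hmU g).2 (Or.inl hXg), fun hh => hg (Or.inr hh)⟩ fun hh => hg (Or.inl hh),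
        mul_zero]

/-- The strong matroid of a Grassmann–Plücker function. -/
def GPRepresents.strongMatroid (h : GPRepresents φ N) : StrongMatroid F E where
  circuits := GPRepresents.vectors φ N
  zero_notMem hh := by
    have := hh.1.nonempty
    simp at this
  smul_mem X hX α hα := by
    refine ⟨?_, fun y => (hX.2 y).smul hα⟩
    have : (Function.support fun e => α * X e) = Function.support X := by
      ext f
      simp [hα]
    rw [this]
    exact hX.1
  incomparable X hX Y hY hXY :=
    h.eq_smul_of_perp hX.1 (hX.1.eq_of_subset_isCircuit hY.1 hXY).symm hX.2 hY.2
  elimination k X Y e hX hY hmod hsub heY he := h.elimination hX hY hmod hsub heY he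

end Elimination

/-! ### The underlying matroid of a strong matroid -/

section Underlying

variable {E : Type*} {F : Type*} [Hyperfield F]

namespace StrongMatroid

variable (M : StrongMatroid F E)

-- Elimination for `k = 1`. Wherever one of the two vectors vanishes, the hypersum is a singleton,
-- so `Z` is known exactly there.
open HSet in
lemma exists_eliminate_pair {X Y : E → F} (hX : X ∈ M.circuits) (hY : Y ∈ M.circuits)
    (hmod : IsModularFamily (supports M.circuits)
      (Fin.cons (Function.support X) fun _ => Function.support Y : Fin (1 + 1) → Set E))
    {e : E} (he : X e = -Y e) (hXe : X e ≠ 0) :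
    ∃ Z ∈ M.circuits, Z e = 0 ∧ (∀ f, Y f = 0 → Z f = X f) ∧ (∀ f, X f = 0 → Z f = Y f) := by
  have hYe : Y e ≠ 0 := by
    rwa [he, Ne, Hyperfield.neg_eq_zero'] at hXe
  have hne : Function.support X ≠ Function.support Y := by
    intro h
    have := hmod.1 (a₁ := 0) (a₂ := 1) h
    exact absurd this (by decide)
  obtain ⟨Z, hZ, hZe, hZf⟩ := M.elimination 1 X (fun _ => Y) (fun _ => e) hX (fun _ => hY) hmod
    (by
      intro hsub
      rw [Set.iUnion_const] at hsub
      obtain ⟨α, hα, h⟩ := M.incomparable X hX Y hY hsub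
      refine hne ?_
      ext f
      simp [h f, hα])
    (fun i j hij => absurd (Subsingleton.elim j i) hij) (fun _ => ⟨he, hXe, hYe⟩)
  refine ⟨Z, hZ, hZe 0, fun f hf => ?_, fun f hf => ?_⟩
  · have := hZf f
    rwa [mem_hsum_cons_ofFn_iff, Fin.sum_univ_one, hf, single_zero, add_zero, mem_single] at this
  · have := hZf f
    rwa [mem_hsum_cons_ofFn_iff, Fin.sum_univ_one, hf, single_zero, zero_add, mem_single] at this

lemma support_smul {X : E → F} {α : F} (hα : α ≠ 0) :
    (Function.support fun e => α * X e) = Function.support X := by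
  ext f
  simp [hα]

lemma exists_isUnderlying [Finite E] : ∃ N : Matroid E, M.IsUnderlying N := by
  have h0 : ∅ ∉ supports M.circuits := by
    rintro ⟨X, hX, h⟩
    rw [Function.support_eq_empty_iff] at h
    rw [h] at hX
    exact M.zero_notMem hX
  have hanti : ∀ A ∈ supports M.circuits, ∀ B ∈ supports M.circuits, A ⊆ B → A = B := by
    rintro _ ⟨X, hX, rfl⟩ _ ⟨Y, hY, rfl⟩ hXY
    obtain ⟨α, hα, h⟩ := M.incomparable X hX Y hY hXY
    ext f
    simp [h f, hα]
  refine exists_matroid_of_elimination h0 hanti fun A hA B hB hAB e he =>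
    elimination_of_modular_elimination h0 hanti ?_ hA hB hAB he
  rintro _ ⟨X, hX, rfl⟩ _ ⟨Y, hY, rfl⟩ hmod e ⟨heX, heY⟩
  have heX : X e ≠ 0 := heX
  have heY : Y e ≠ 0 := heY
  -- Scaling `Y` by this factor makes its value at `e` the negative of `X e`, without changing its
  -- support.
  have hα : -(X e / Y e) ≠ 0 := Hyperfield.neg_eq_zero'.not.2 (div_ne_zero heX heY)
  rw [← support_smul (X := Y) hα] at hmod
  obtain ⟨Z, hZ, hZe, hZ1, hZ2⟩ := M.exists_eliminate_pair hX (M.smul_mem Y hY _ hα) hmod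
    (by rw [neg_mul, neg_neg, div_mul_cancel₀ _ heY]) heX
  refine ⟨_, ⟨Z, hZ, rfl⟩, fun f hf => ⟨?_, fun hfe => ?_⟩⟩
  · by_contra hcon
    rw [Set.mem_union, not_or, Function.notMem_support, Function.notMem_support] at hcon
    exact hf ((hZ1 f (by rw [hcon.2, mul_zero])).trans hcon.1)
  · exact hf (by rw [show f = e from hfe, hZe])

lemma IsUnderlying.unique {N N' : Matroid E} {M : StrongMatroid F E} (h : M.IsUnderlying N)
    (h' : M.IsUnderlying N') : N = N' :=
  Matroid.ext_isCircuit (h.1.trans h'.1.symm) fun C _ => (h.2 C).trans (h'.2 C).symm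

lemma IsUnderlying.exists_mem {N : Matroid E} {M : StrongMatroid F E} (h : M.IsUnderlying N)
    {C : Set E} (hC : N.IsCircuit C) : ∃ X ∈ M.circuits, Function.support X = C :=
  (h.2 C).1 hC

lemma IsUnderlying.isCircuit {N : Matroid E} {M : StrongMatroid F E} (h : M.IsUnderlying N)
    {X : E → F} (hX : X ∈ M.circuits) : N.IsCircuit (Function.support X) :=
  (h.2 _).2 ⟨X, hX, rfl⟩

end StrongMatroid

/-! ### Signs of tuples -/

/-- Moving entry `j` to the front is undone by a cycle of sign `(-1) ^ j`. -/
lemma IsAlternating.map_cons_succAbove {m : ℕ} {φ : (Fin (m + 1) → E) → F} (hφ : IsAlternating φ)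
    (u : Fin (m + 1) → E) (j : Fin (m + 1)) :
    φ u = (-1) ^ (j : ℕ) * φ (Fin.cons (u j) (u ∘ j.succAbove)) := by
  have h : (Fin.cons (u j) (u ∘ j.succAbove) : Fin (m + 1) → E) ∘ j.cycleRange = u := by
    funext i
    rw [Function.comp_apply, Fin.cons_apply_cycleRange]
    exact congrFun (Fin.insertNth_self_removeNth j u) i
  conv_lhs => rw [← h]
  rw [hφ.map_perm, Fin.sign_cycleRange, map_pow, unitsSign_neg, map_one]

-- Choose one enumeration of every set of `r` elements and take the sign of the permutation relative
-- to it. Multiplying by `ε` passes between alternating functions on tuples and functions on sets.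
variable (F) in
lemma exists_isAlternating_sign [Nonempty E] (r : ℕ) : ∃ ε : (Fin r → E) → F, IsAlternating ε ∧
    ∀ x, Function.Injective x → ε x * ε x = 1 := by
  classical
  have href : ∀ S : Set E, ∃ z : Fin r → E,
      (∃ x : Fin r → E, Function.Injective x ∧ Set.range x = S) →
        Function.Injective z ∧ Set.range z = S := fun S => by
    by_cases h : ∃ x : Fin r → E, Function.Injective x ∧ Set.range x = S
    · obtain ⟨x, hx⟩ := h
      exact ⟨x, fun _ => hx⟩
    · exact ⟨fun _ => Classical.arbitrary E, fun hh => absurd hh h⟩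
  choose z hz using href
  have hperm : ∀ x : Fin r → E, Function.Injective x →
      ∃ σ : Equiv.Perm (Fin r), x = z (Set.range x) ∘ σ := fun x hx => by
    obtain ⟨h1, h2⟩ := hz (Set.range x) ⟨x, hx, rfl⟩
    exact exists_perm_of_range_eq h1 h2.symm
  have huniq : ∀ x : Fin r → E, Function.Injective x → ∀ σ τ : Equiv.Perm (Fin r),
      x = z (Set.range x) ∘ σ → x = z (Set.range x) ∘ τ → σ = τ := fun x hx σ τ h1 h2 => by
    ext i
    have := (hz (Set.range x) ⟨x, hx, rfl⟩).1 ((congrFun h1 i).symm.trans (congrFun h2 i))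
    rw [this]
  let ε : (Fin r → E) → F := fun x =>
    if h : Function.Injective x then unitsSign F (Equiv.Perm.sign (hperm x h).choose) else 0
  have hε : ∀ x (σ : Equiv.Perm (Fin r)), Function.Injective x → x = z (Set.range x) ∘ σ →
      ε x = unitsSign F (Equiv.Perm.sign σ) := fun x σ hx hσ => by
    simp only [ε]
    rw [dif_pos hx, huniq x hx _ _ (hperm x hx).choose_spec hσ]
  refine ⟨ε, fun x i j hij => ?_, fun x hx => ?_⟩
  · by_cases hx : Function.Injective x
    · obtain ⟨σ, hσ⟩ := hperm x hx
      have hr : Set.range (x ∘ Equiv.swap i j) = Set.range x :=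
        (Equiv.swap i j).surjective.range_comp x
      rw [hε x σ hx hσ, hε (x ∘ Equiv.swap i j) (σ * Equiv.swap i j)
        (hx.comp (Equiv.injective _)) ?_, Equiv.Perm.sign_mul, Equiv.Perm.sign_swap hij, mul_neg_one,
        unitsSign_neg]
      rw [hr]
      conv_lhs => rw [hσ]
      rfl
    · have hx' : ¬ Function.Injective (x ∘ Equiv.swap i j) := fun h => hx (by
        have := h.comp (Equiv.swap i j).injective
        rwa [Function.comp_assoc, ← Equiv.coe_trans, Equiv.swap_swap, Equiv.coe_refl,
          Function.comp_id] at this)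
      simp only [ε]
      rw [dif_neg hx, dif_neg hx', Hyperfield.neg_zero']
  · obtain ⟨σ, hσ⟩ := hperm x hx
    rw [hε x σ hx hσ, unitsSign_mul_self]

end Underlying

/-! ### Basis exchange weights of a strong matroid -/

section Weights

variable {E : Type*} {F : Type*} [Hyperfield F]

lemma range_update {r : ℕ} {x : Fin r → E} (hx : Function.Injective x) (i : Fin r) (q : E) :
    Set.range (Function.update x i q) = exch (Set.range x) (x i) q := by
  ext e
  rw [mem_exch, Set.mem_range]
  constructor
  · rintro ⟨j, rfl⟩
    by_cases hj : j = i
    · subst hj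
      exact Or.inl (Function.update_self _ _ _)
    · rw [Function.update_of_ne hj]
      exact Or.inr ⟨⟨j, rfl⟩, fun h => hj (hx h)⟩
  · rintro (rfl | ⟨⟨j, rfl⟩, hj⟩)
    · exact ⟨i, Function.update_self _ _ _⟩
    · exact ⟨j, Function.update_of_ne (fun h : j = i => hj (congrArg x h)) _ _⟩

lemma injective_update {r : ℕ} {x : Fin r → E} (hx : Function.Injective x) (i : Fin r) {q : E}
    (hq : q ∉ Set.range x) : Function.Injective (Function.update x i q) := by
  intro j k hjk
  by_cases hj : j = i <;> by_cases hk : k = i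
  · rw [hj, hk]
  · rw [hj, Function.update_self, Function.update_of_ne hk] at hjk
    exact absurd ⟨k, hjk.symm⟩ hq
  · rw [hk, Function.update_self, Function.update_of_ne hj] at hjk
    exact absurd ⟨j, hjk⟩ hq
  · rw [Function.update_of_ne hj, Function.update_of_ne hk] at hjk
    exact hx hjk

namespace StrongMatroid

variable {M : StrongMatroid F E} {N : Matroid E}

lemma IsUnderlying.exists_smul (h : M.IsUnderlying N) {X X' : E → F} (hX : X ∈ M.circuits)
    (hX' : X' ∈ M.circuits) {I : Set E} (hI : N.Indep I) {q : E}
    (hs : Function.support X ⊆ insert q I) (hs' : Function.support X' ⊆ insert q I) :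
    ∃ α : F, α ≠ 0 ∧ ∀ e, X e = α * X' e := by
  refine M.incomparable X hX X' hX' ?_
  rw [(h.isCircuit hX).eq_fundCircuit_of_subset hI hs,
    (h.isCircuit hX').eq_fundCircuit_of_subset hI hs']

/-- The relation between two bases that differ by an exchange and the weight of the exchange. -/
def IsWeight {r : ℕ} (M : StrongMatroid F E) (ε : (Fin r → E) → F) (B B' : Set E) (c : F) :
    Prop :=
  ∃ (x : Fin r → E) (i : Fin r) (q : E) (X : E → F), Function.Injective x ∧ Set.range x = B ∧
    q ∉ B ∧ B' = exch B (x i) q ∧ X ∈ M.circuits ∧ Function.support X ⊆ insert q B ∧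
    -- Orthogonality would force `φ (update x i q) / φ x` to be `-(X (x i) / X q)`; the two signs
    -- turn this into a ratio for a function of the underlying sets.
    c = -(X (x i) / X q) * (ε x * ε (Function.update x i q))

/-- Reordering the tuple changes both signs `ε` by the same factor, and the circuit vector is unique
up to a scalar, which cancels in the ratio. -/
lemma IsUnderlying.isWeight_unique (h : M.IsUnderlying N) {r : ℕ} {ε : (Fin r → E) → F}
    (hε : IsAlternating ε) {B B' : Set E} (hB : N.IsBase B) {c c' : F}
    (hc : M.IsWeight ε B B' c) (hc' : M.IsWeight ε B B' c') : c = c' := by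
  obtain ⟨x, i, q, X, hx, hxB, hq, hB', hX, hXs, rfl⟩ := hc
  obtain ⟨x', i', q', X', hx', hxB', hq', hB'', hX', hXs', rfl⟩ := hc'
  have hqq : q = q' := by
    have : q ∈ B' := hB' ▸ Or.inl rfl
    rw [hB''] at this
    exact this.resolve_right fun hh => hq hh.1
  subst hqq
  obtain ⟨σ, rfl⟩ := exists_perm_of_range_eq hx (hxB'.trans hxB.symm)
  have hxi : x (σ i') = x i := by
    by_contra hne
    have : x (σ i') ∈ B' := by
      rw [hB']
      exact Or.inr ⟨hxB ▸ ⟨_, rfl⟩, hne⟩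
    rw [hB''] at this
    rcases this with hh | hh
    · exact hq (hh ▸ hxB ▸ ⟨_, rfl⟩)
    · exact hh.2 rfl
  have hi : σ i' = i := hx hxi
  obtain ⟨α, hα, hXX⟩ := h.exists_smul hX hX' hB.indep hXs hXs'
  have hup : Function.update (x ∘ σ) i' q = Function.update x i q ∘ σ := by
    rw [← hi, Function.update_comp_eq_of_injective x σ.injective]
  rw [hup, hε.map_perm, hε.map_perm, Function.comp_apply, hi, hXX, hXX q, mul_div_mul_left _ _ hα,
    mul_mul_mul_comm (unitsSign F _), unitsSign_mul_self, one_mul]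

open Classical in
/-- The weight of an exchange. -/
noncomputable def weight {r : ℕ} (M : StrongMatroid F E) (ε : (Fin r → E) → F) (B B' : Set E) : F :=
  if h : ∃ c, M.IsWeight ε B B' c then h.choose else 1

lemma IsUnderlying.weight_eq (h : M.IsUnderlying N) {r : ℕ} {ε : (Fin r → E) → F}
    (hε : IsAlternating ε) {x : Fin r → E} (hx : Function.Injective x)
    (hB : N.IsBase (Set.range x)) (i : Fin r) {q : E} (hq : q ∉ Set.range x) {X : E → F}
    (hX : X ∈ M.circuits) (hXs : Function.support X ⊆ insert q (Set.range x)) :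
    M.weight ε (Set.range x) (Set.range (Function.update x i q)) =
      -(X (x i) / X q) * (ε x * ε (Function.update x i q)) := by
  have hw : M.IsWeight ε (Set.range x) (Set.range (Function.update x i q))
      (-(X (x i) / X q) * (ε x * ε (Function.update x i q))) :=
    ⟨x, i, q, X, hx, rfl, hq, range_update hx i q, hX, hXs, rfl⟩
  have hex : ∃ c, M.IsWeight ε (Set.range x) (Set.range (Function.update x i q)) c := ⟨_, hw⟩
  rw [weight, dif_pos hex]
  exact h.isWeight_unique hε hB hex.choose_spec hw

/-- The circuits in the three exchanges between `D + p`, `D + q` and `D + s` are related. -/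
lemma IsUnderlying.div_mul_div [Finite E] (h : M.IsUnderlying N) {D : Set E} {p q s : E}
    (hp : p ∉ D) (hq : q ∉ D) (hpq : p ≠ q) (hps : p ≠ s) (hqs : q ≠ s)
    (hBq : N.IsBase (insert q D)) (hBs : N.IsBase (insert s D))
    {X Y Z : E → F} (hX : X ∈ M.circuits) (hY : Y ∈ M.circuits) (hZ : Z ∈ M.circuits)
    (hXs : Function.support X ⊆ insert s (insert q D))
    (hYs : Function.support Y ⊆ insert p (insert s D))
    (hZs : Function.support Z ⊆ insert p (insert q D))
    (hXq : X q ≠ 0) (hXs0 : X s ≠ 0) (hYs0 : Y s ≠ 0) (hYp : Y p ≠ 0) :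
    X q / X s * (Y s / Y p) = -(Z q / Z p) := by
  have hsub : ∀ X : Set E, X ⊆ N.E := fun X => by rw [h.1]; exact Set.subset_univ X
  have hXp : X p = 0 := by
    by_contra hne
    rcases hXs hne with hh | hh | hh
    exacts [hps hh, hpq hh, hp hh]
  have hYq : Y q = 0 := by
    by_contra hne
    rcases hYs hne with hh | hh | hh
    exacts [hpq hh.symm, hqs hh, hq hh]
  have hα : -(X s / Y s) ≠ 0 := Hyperfield.neg_eq_zero'.not.2 (div_ne_zero hXs0 hYs0)
  have hU : (⋃ i, (Fin.cons (Function.support X) fun _ => Function.support Y :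
      Fin (1 + 1) → Set E) i) = Function.support X ∪ Function.support Y := by
    ext e
    simp
  have hcX := h.isCircuit hX
  have hcY := h.isCircuit hY
  set U := Function.support X ∪ Function.support Y with hUdef
  have hsubI : U \ {p, q} ⊆ insert s D := by
    rintro e ⟨heU, hepq⟩
    rw [Set.mem_insert_iff, Set.mem_singleton_iff, not_or] at hepq
    rcases heU with he | he
    · rcases hXs he with hh | hh | hh
      exacts [Or.inl hh, absurd hh hepq.2, Or.inr hh]
    · exact (hYs he).resolve_left hepq.1
  -- The union has nullity two, with `p` and `q` spanned by what remains. So `X` and `Y` form a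
  -- modular pair from which `s` can be eliminated.
  have hI : N.IsBasis (U \ {p, q}) U := by
    refine (hBs.indep.subset hsubI).isBasis_of_subset_of_subset_closure Set.sdiff_subset ?_
    intro e he
    by_cases hep : e = p
    · subst hep
      refine N.closure_subset_closure ?_ (hcY.mem_closure_sdiff_singleton_of_mem hYp)
      rintro f ⟨hf, hfp⟩
      refine ⟨Or.inr hf, ?_⟩
      rintro (rfl | rfl)
      · exact hfp rfl
      · exact hf hYq
    by_cases heq : e = q
    · subst heq
      refine N.closure_subset_closure ?_ (hcX.mem_closure_sdiff_singleton_of_mem hXq)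
      rintro f ⟨hf, hfq⟩
      refine ⟨Or.inl hf, ?_⟩
      rintro (rfl | rfl)
      · exact hf hXp
      · exact hfq rfl
    · exact N.subset_closure _ (hsub _) ⟨he, fun hh => hh.elim hep heq⟩
  have hmod : IsModularFamily (supports M.circuits)
      (Fin.cons (Function.support X) fun _ => Function.support Y : Fin (1 + 1) → Set E) := by
    refine (isModularFamily_iff h.1 h.2 (hU ▸ hI)).2 ⟨?_, ?_, ?_⟩
    · refine Fin.cons_injective_iff.2 ⟨?_, Function.injective_of_subsingleton _⟩
      intro hmem
      obtain ⟨-, hh⟩ := Set.mem_range.1 hmem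
      have hqX : q ∈ Function.support X := hXq
      rw [← hh] at hqX
      exact hqX hYq
    · exact fun i => Fin.cases ⟨X, hX, rfl⟩ (fun _ => ⟨Y, hY, rfl⟩) i
    · rw [hU, Set.sdiff_sdiff_cancel_left, Set.ncard_pair hpq]
      rintro e (rfl | rfl)
      exacts [Or.inr hYp, Or.inl hXq]
  rw [← support_smul (X := Y) hα] at hmod
  obtain ⟨W, hW, hWs, hWX, hWY⟩ := M.exists_eliminate_pair hX (M.smul_mem Y hY _ hα) hmod
    (by rw [neg_mul, neg_neg, div_mul_cancel₀ _ hYs0]) hXs0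
  -- With `s` eliminated, `W` lives on the circuit inside `D + p + q` and is a multiple of `Z`; its
  -- values at `p` and `q` are known because one of `X`, `Y` vanishes there.
  have hWsub : Function.support W ⊆ insert p (insert q D) := by
    intro e he
    have hes : e ≠ s := fun hh => he (hh ▸ hWs)
    by_cases hYe : Y e = 0
    · have hXe : X e ≠ 0 := by
        rw [← hWX e (by rw [hYe, mul_zero])]
        exact he
      exact Or.inr ((hXs hXe).resolve_left hes)
    · rcases hYs hYe with hh | hh | hh
      exacts [Or.inl hh, absurd hh hes, Or.inr (Or.inr hh)]
  obtain ⟨α, hα0, hWZ⟩ := h.exists_smul hW hZ hBq.indep hWsub hZs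
  have e1 : W q = X q := hWX q (by rw [hYq, mul_zero])
  have e2 : W p = -(X s / Y s) * Y p := hWY p hXp
  have e3 : W q / W p = Z q / Z p := by rw [hWZ, hWZ p, mul_div_mul_left _ _ hα0]
  rw [← e3, e1, e2, neg_mul, div_eq_mul_inv, div_eq_mul_inv, div_eq_mul_inv, div_eq_mul_inv,
    inv_neg, mul_inv, mul_inv, inv_inv, mul_neg, neg_neg]
  ac_rfl

end StrongMatroid

end Weights

/-! ### The Grassmann–Plücker function of a strong matroid -/

section Construction

variable {E : Type*} {F : Type*} [Hyperfield F] [Finite E]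

namespace StrongMatroid.IsUnderlying

variable {M : StrongMatroid F E} {N : Matroid E} {r : ℕ} {ε : (Fin r → E) → F}

omit [Finite E] in
lemma exists_vector (h : M.IsUnderlying N) {B : Set E} (hB : N.IsBase B) {q : E} (hq : q ∉ B) :
    ∃ X ∈ M.circuits, Function.support X ⊆ insert q B ∧ X q ≠ 0 := by
  obtain ⟨X, hX, hXs⟩ := h.exists_mem (hB.fundCircuit_isCircuit (h.1 ▸ Set.mem_univ q) hq)
  refine ⟨X, hX, hXs ▸ N.fundCircuit_subset_insert q B, ?_⟩
  have : q ∈ Function.support X := hXs ▸ N.mem_fundCircuit q B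
  exact this

omit [Finite E] in
lemma apply_ne_zero (h : M.IsUnderlying N) {B : Set E} (hB : N.IsBase B) {p q : E} (hp : p ∈ B)
    (hq : q ∉ B) (h' : N.IsBase (exch B p q)) {X : E → F} (hX : X ∈ M.circuits)
    (hXs : Function.support X ⊆ insert q B) : X p ≠ 0 :=
  ((h.isCircuit hX).mem_of_isBase_exch hB hp hq h' hXs).1

lemma exists_tuple (hr : ∀ B, N.IsBase B → B.ncard = r) {B : Set E} (hB : N.IsBase B) :
    ∃ x : Fin r → E, Function.Injective x ∧ B = Set.range x := by
  obtain ⟨x, hx, hxB⟩ := exists_injective_range_eq (hr B hB)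
  exact ⟨x, hx, hxB.symm⟩

omit [Finite E] in
lemma mul_sign_mul_sign (hε1 : ∀ x, Function.Injective x → ε x * ε x = 1) {x : Fin r → E}
    (hx : Function.Injective x) (u v a b : F) :
    u * (a * ε x) * (v * (ε x * b)) = u * v * (a * b) := by
  rw [mul_mul_mul_comm, mul_assoc a, ← mul_assoc (ε x), hε1 x hx, one_mul]

/-- One circuit serves both directions of the exchange, and its two ratios are inverse. -/
lemma weight_anti (h : M.IsUnderlying N) (hr : ∀ B, N.IsBase B → B.ncard = r)
    (hε : IsAlternating ε) (hε1 : ∀ x, Function.Injective x → ε x * ε x = 1) (B : Set E) (p q : E)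
    (hB : N.IsBase B) (hp : p ∈ B) (hq : q ∉ B) (hB' : N.IsBase (exch B p q)) :
    M.weight ε B (exch B p q) * M.weight ε (exch B p q) B = 1 := by
  obtain ⟨x, hx, rfl⟩ := exists_tuple hr hB
  obtain ⟨i, rfl⟩ := hp
  obtain ⟨X, hX, hXs, hXq⟩ := h.exists_vector hB hq
  have hXp := h.apply_ne_zero hB ⟨i, rfl⟩ hq hB' hX hXs
  have hx' := injective_update hx i hq
  have hback : Function.update (Function.update x i q) i (x i) = x := by
    rw [Function.update_idem, Function.update_eq_self]
  have hp' : x i ∉ Set.range (Function.update x i q) := by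
    rw [range_update hx]
    rintro (hh | hh)
    exacts [hq ⟨i, hh⟩, hh.2 rfl]
  have hXs' : Function.support X ⊆ insert (x i) (Set.range (Function.update x i q)) := by
    intro e he
    rw [range_update hx]
    by_cases hei : e = x i
    · exact Or.inl hei
    · exact Or.inr ((hXs he).imp id fun hh => ⟨hh, hei⟩)
  rw [← range_update hx] at hB' ⊢
  have e1 := h.weight_eq hε hx hB i hq hX hXs
  have e2 := h.weight_eq hε hx' hB' i hp' hX hXs'
  rw [hback, Function.update_self] at e2
  rw [e1, e2, mul_sign_mul_sign hε1 hx', hε1 x hx, mul_one, neg_mul_neg,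
    div_mul_div_cancel₀ hXq, div_self hXp]

/-- The three bases share `B \ {p}`, and each pair of them has its own circuit. Relating three
circuits takes elimination, through `div_mul_div`. -/
lemma weight_star (h : M.IsUnderlying N) (hr : ∀ B, N.IsBase B → B.ncard = r)
    (hε : IsAlternating ε) (hε1 : ∀ x, Function.Injective x → ε x * ε x = 1)
    (B : Set E) (p q s : E)
    (hB : N.IsBase B) (hp : p ∈ B) (hq : q ∉ B) (hs : s ∉ B) (hqs : q ≠ s)
    (hBq : N.IsBase (exch B p q)) (hBs : N.IsBase (exch B p s)) :
    M.weight ε (exch B p q) (exch B p s) * M.weight ε (exch B p s) B =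
      M.weight ε (exch B p q) B := by
  obtain ⟨x, hx, rfl⟩ := exists_tuple hr hB
  obtain ⟨i, rfl⟩ := hp
  have hpq : x i ≠ q := fun hh => hq ⟨i, hh⟩
  have hps : x i ≠ s := fun hh => hs ⟨i, hh⟩
  have hxq := injective_update hx i hq
  have hxs := injective_update hx i hs
  have hsq : s ∉ Set.range (Function.update x i q) := by
    rw [range_update hx]
    rintro (hh | hh)
    exacts [hqs hh.symm, hs hh.1]
  have hpq' : x i ∉ Set.range (Function.update x i q) := by
    rw [range_update hx]
    rintro (hh | hh)
    exacts [hpq hh, hh.2 rfl]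
  have hps' : x i ∉ Set.range (Function.update x i s) := by
    rw [range_update hx]
    rintro (hh | hh)
    exacts [hps hh, hh.2 rfl]
  rw [← range_update hx] at hBq hBs
  obtain ⟨X, hX, hXs, hXs0⟩ := h.exists_vector hBq hsq
  obtain ⟨Y, hY, hYs, hYp⟩ := h.exists_vector hBs hps'
  obtain ⟨Z, hZ, hZs, hZp⟩ := h.exists_vector hBq hpq'
  have e1 := h.weight_eq hε hxq hBq i hsq hX hXs
  have e2 := h.weight_eq hε hxs hBs i hps' hY hYs
  have e3 := h.weight_eq hε hxq hBq i hpq' hZ hZs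
  rw [Function.update_idem, Function.update_self] at e1
  rw [Function.update_idem, Function.update_self, Function.update_eq_self] at e2 e3
  have hXq : X q ≠ 0 := by
    refine h.apply_ne_zero hBq ?_ hsq ?_ hX hXs
    · rw [range_update hx]
      exact Or.inl rfl
    · rwa [range_update hx, exch_exch_left hq, ← range_update hx]
  have hYs0 : Y s ≠ 0 := by
    refine h.apply_ne_zero hBs ?_ hps' ?_ hY hYs
    · rw [range_update hx]
      exact Or.inl rfl
    · rwa [range_update hx, exch_exch_cancel (Set.mem_range_self i) hs]
  rw [← range_update hx, ← range_update hx, e1, e2, e3]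
  rw [range_update hx] at hXs hYs hZs hBq hBs
  have := h.div_mul_div (D := Set.range x \ {x i}) (fun hh => hh.2 rfl) (fun hh => hq hh.1) hpq hps
    hqs hBq hBs hX hY hZ hXs hYs hZs hXq hXs0 hYs0 hYp
  rw [mul_sign_mul_sign hε1 hxs, neg_mul_neg, this]

omit [Finite E] in
lemma weight_tri_sign (hε : IsAlternating ε) {x : Fin r → E} {i j : Fin r} (hij : i ≠ j) (q : E) :
    ε (Function.update (Function.update x i q) j (x i)) = -ε (Function.update x j q) := by
  rw [← hε _ i j hij]
  congr 1
  funext k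
  simp only [Function.comp_apply, Function.update_apply, Equiv.swap_apply_def]
  split_ifs <;> simp_all

/-- All three bases lie in `B ∪ {q}`, so a single circuit gives the three ratios. The transposition
in `weight_tri_sign` supplies the missing minus sign. -/
lemma weight_tri (h : M.IsUnderlying N) (hr : ∀ B, N.IsBase B → B.ncard = r)
    (hε : IsAlternating ε) (hε1 : ∀ x, Function.Injective x → ε x * ε x = 1)
    (B : Set E) (p s q : E)
    (hB : N.IsBase B) (hp : p ∈ B) (hs : s ∈ B) (hps : p ≠ s) (hq : q ∉ B)
    (hBp : N.IsBase (exch B p q)) (hBs : N.IsBase (exch B s q)) :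
    M.weight ε (exch B p q) (exch B s q) * M.weight ε (exch B s q) B =
      M.weight ε (exch B p q) B := by
  obtain ⟨x, hx, rfl⟩ := exists_tuple hr hB
  obtain ⟨i, rfl⟩ := hp
  obtain ⟨j, rfl⟩ := hs
  have hij : i ≠ j := fun hh => hps (congrArg x hh)
  obtain ⟨X, hX, hXs, hXq⟩ := h.exists_vector hB hq
  have hXp := h.apply_ne_zero hB ⟨i, rfl⟩ hq hBp hX hXs
  have hXs0 := h.apply_ne_zero hB ⟨j, rfl⟩ hq hBs hX hXs
  have hxi := injective_update hx i hq
  have hxj := injective_update hx j hq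
  have hnot : ∀ i, x i ∉ Set.range (Function.update x i q) := fun i => by
    rw [range_update hx]
    rintro (hh | hh)
    exacts [hq ⟨i, hh⟩, hh.2 rfl]
  have hsub : ∀ i, Function.support X ⊆ insert (x i) (Set.range (Function.update x i q)) := by
    intro i e he
    rw [range_update hx]
    by_cases hei : e = x i
    · exact Or.inl hei
    · exact Or.inr ((hXs he).imp id fun hh => ⟨hh, hei⟩)
  rw [← range_update hx] at hBp hBs
  have hr' : Set.range (Function.update (Function.update x i q) j (x i)) =
      exch (Set.range x) (x j) q := by
    have hji : Function.update x i q j = x j := Function.update_of_ne (Ne.symm hij) _ _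
    rw [range_update hxi, hji, range_update hx, exch_exch_right (Set.mem_range_self i)
      (fun hh : x j = q => hq ⟨j, hh⟩) (Ne.symm hps)]
  have e1 := h.weight_eq hε hxi hBp j (hnot i) hX (hsub i)
  have e2 := h.weight_eq hε hxj hBs j (hnot j) hX (hsub j)
  have e3 := h.weight_eq hε hxi hBp i (hnot i) hX (hsub i)
  rw [Function.update_of_ne (Ne.symm hij), weight_tri_sign hε hij, hr', ← range_update hx] at e1
  rw [Function.update_idem, Function.update_self, Function.update_eq_self] at e2 e3
  rw [← range_update hx, ← range_update hx, e1, e2, e3, mul_neg, mul_neg, neg_mul,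
    mul_sign_mul_sign hε1 hxj, neg_mul_neg, mul_comm (X (x j) / X (x i)),
    div_mul_div_cancel₀ hXs0, neg_mul]

/-- Without diagonals, the circuit of `q` avoids `p'` and that of `q'` avoids `p`. Each therefore
governs two opposite sides of the square, which get equal ratios. -/
lemma weight_square (h : M.IsUnderlying N) (hr : ∀ B, N.IsBase B → B.ncard = r)
    (hε : IsAlternating ε) (hε1 : ∀ x, Function.Injective x → ε x * ε x = 1)
    (B : Set E) (p p' q q' : E)
    (hB : N.IsBase B) (hp : p ∈ B) (hp' : p' ∈ B) (hpp : p ≠ p') (hq : q ∉ B) (hq' : q' ∉ B)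
    (hqq : q ≠ q') (h1 : N.IsBase (exch B p q)) (h2 : N.IsBase (exch B p' q'))
    (h3 : ¬ N.IsBase (exch B p q')) (h4 : ¬ N.IsBase (exch B p' q))
    (h5 : N.IsBase (exch (exch B p q) p' q')) :
    M.weight ε (exch (exch B p q) p' q') (exch B p q) * M.weight ε (exch B p q) B =
      M.weight ε (exch (exch B p q) p' q') (exch B p' q') * M.weight ε (exch B p' q') B := by
  obtain ⟨x, hx, rfl⟩ := exists_tuple hr hB
  obtain ⟨i, rfl⟩ := hp
  obtain ⟨j, rfl⟩ := hp'
  have hij : i ≠ j := fun hh => hpp (congrArg x hh)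
  have hne : ∀ k, x k ≠ q := fun k hh => hq ⟨k, hh⟩
  have hne' : ∀ k, x k ≠ q' := fun k hh => hq' ⟨k, hh⟩
  obtain ⟨X, hX, hXs, hXq⟩ := h.exists_vector hB hq
  obtain ⟨Y, hY, hYs, hYq⟩ := h.exists_vector hB hq'
  have hXj : X (x j) = 0 := by
    by_contra hh
    exact h4 ((h.isCircuit hX).isBase_exch hB hXs hh (hne j))
  have hYi : Y (x i) = 0 := by
    by_contra hh
    exact h3 ((h.isCircuit hY).isBase_exch hB hYs hh (hne' i))
  have hxi := injective_update hx i hq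
  have hxj := injective_update hx j hq'
  have hm1 : x i ∉ Set.range (Function.update x i q) := by
    rw [range_update hx]
    rintro (hh | hh)
    exacts [hne i hh, hh.2 rfl]
  have hm2 : x j ∉ Set.range (Function.update x j q') := by
    rw [range_update hx]
    rintro (hh | hh)
    exacts [hne' j hh, hh.2 rfl]
  have hq'i : q' ∉ Set.range (Function.update x i q) := by
    rw [range_update hx]
    rintro (hh | hh)
    exacts [hqq hh.symm, hq' hh.1]
  have hji : Function.update x i q j = x j := Function.update_of_ne (Ne.symm hij) _ _
  have hxij := injective_update hxi j hq'i
  have hcomm : Function.update (Function.update x i q) j q' =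
      Function.update (Function.update x j q') i q := Function.update_comm hij _ _ _
  have hr5 : Set.range (Function.update (Function.update x i q) j q') =
      exch (exch (Set.range x) (x i) q) (x j) q' := by
    rw [range_update hxi, hji, range_update hx]
  have hm3 : x j ∉ Set.range (Function.update (Function.update x i q) j q') := by
    rw [hr5]
    rintro (hh | hh)
    exacts [hne' j hh, hh.2 rfl]
  have hm4 : x i ∉ Set.range (Function.update (Function.update x i q) j q') := by
    rw [hr5]
    rintro (hh | ⟨hh | hh, -⟩)
    exacts [hne' i hh, hne i hh, hh.2 rfl]
  have hXs1 : Function.support X ⊆ insert (x i) (Set.range (Function.update x i q)) := by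
    intro e he
    rw [range_update hx]
    by_cases hei : e = x i
    · exact Or.inl hei
    · exact Or.inr ((hXs he).imp id fun hh => ⟨hh, hei⟩)
  have hYs1 : Function.support Y ⊆ insert (x j) (Set.range (Function.update x j q')) := by
    intro e he
    rw [range_update hx]
    by_cases hej : e = x j
    · exact Or.inl hej
    · exact Or.inr ((hYs he).imp id fun hh => ⟨hh, hej⟩)
  have hXs2 : Function.support X ⊆
      insert (x i) (Set.range (Function.update (Function.update x i q) j q')) := by
    intro e he
    rw [hr5]
    refine (hXs1 he).imp id fun hh => Or.inr ⟨by rwa [range_update hx] at hh, ?_⟩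
    rintro rfl
    exact he hXj
  have hYs2 : Function.support Y ⊆
      insert (x j) (Set.range (Function.update (Function.update x i q) j q')) := by
    intro e he
    rw [hr5]
    have hei : e ≠ x i := by
      rintro rfl
      exact he hYi
    by_cases hej : e = x j
    · exact Or.inl hej
    · exact Or.inr ((hYs he).imp id fun hh => ⟨Or.inr ⟨hh, hei⟩, hej⟩)
  rw [← hr5] at h5 ⊢
  rw [← range_update hx] at h1 h2
  have e1 := h.weight_eq hε hxij h5 j hm3 hY hYs2
  have e2 := h.weight_eq hε hxi h1 i hm1 hX hXs1
  have e3 := h.weight_eq hε hxij h5 i hm4 hX hXs2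
  have e4 := h.weight_eq hε hxj h2 j hm2 hY hYs1
  rw [Function.update_self, Function.update_idem,
    show Function.update (Function.update x i q) j (x j) = Function.update x i q by
      conv_lhs => rw [← hji]
      exact Function.update_eq_self _ _] at e1
  rw [Function.update_idem, Function.update_self, Function.update_eq_self] at e2 e4
  have hij' : Function.update x j q' i = x i := Function.update_of_ne hij _ _
  rw [Function.update_of_ne hij, Function.update_self,
    show Function.update (Function.update (Function.update x i q) j q') i (x i) =
      Function.update x j q' by
      rw [hcomm, Function.update_idem]
      conv_lhs => rw [← hij']
      exact Function.update_eq_self _ _] at e3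
  rw [← range_update hx, ← range_update hx, e1, e2, e3, e4,
    mul_sign_mul_sign hε1 hxi, mul_sign_mul_sign hε1 hxj, mul_comm (-(Y q' / Y (x j)))]

end StrongMatroid.IsUnderlying

end Construction

/-! ### Compatible functions and orthogonality of circuits -/

section Construction

variable {E : Type*} {F : Type*} [Hyperfield F]

namespace StrongMatroid.IsUnderlying

variable {M : StrongMatroid F E} {N : Matroid E} {n : ℕ} {φ : (Fin (n + 1) → E) → F}

/-- The compatibility of a function on tuples with the exchange ratios given by the circuits. -/
def Compatible (M : StrongMatroid F E) (N : Matroid E) (φ : (Fin (n + 1) → E) → F) : Prop :=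
  ∀ (z : Fin n → E) (p q : E) (X : E → F), N.IsBase (insert p (Set.range z)) → X ∈ M.circuits →
    Function.support X ⊆ insert q (insert p (Set.range z)) → X q ≠ 0 →
      X q * φ (Fin.cons q z) = -(X p * φ (Fin.cons p z))

/-- A function on tuples whose exchange ratios are given by the circuits of a strong matroid. -/
lemma exists_compatible [Finite E] [Nonempty E] (h : M.IsUnderlying N)
    (hr : ∀ B, N.IsBase B → B.ncard = n + 1) :
    ∃ φ : (Fin (n + 1) → E) → F, IsAlternating φ ∧
      (∀ x, N.IsBase (Set.range x) ↔ φ x ≠ 0) ∧ Compatible M N φ := by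
  classical
  obtain ⟨ε, hε, hε1⟩ := exists_isAlternating_sign (E := E) F (n + 1)
  obtain ⟨g, hg, hgw⟩ := exists_potential (N := N) (M.weight ε) (h.weight_anti hr hε hε1)
    (h.weight_star hr hε hε1) (h.weight_tri hr hε hε1) (h.weight_square hr hε hε1)
  let φ : (Fin (n + 1) → E) → F := fun x => if N.IsBase (Set.range x) then
    g (Set.range x) * ε x else 0
  have hφ1 : ∀ x, N.IsBase (Set.range x) → φ x = g (Set.range x) * ε x := fun x hx => if_pos hx
  have hφ0 : ∀ x, ¬ N.IsBase (Set.range x) → φ x = 0 := fun x hx => if_neg hx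
  have hε0 : ∀ x, Function.Injective x → ε x ≠ 0 := fun x hx h0 => by
    have := hε1 x hx
    rw [h0, mul_zero] at this
    exact zero_ne_one this
  refine ⟨φ, fun x i j hij => ?_, fun x => ⟨fun hx => ?_, fun hx => ?_⟩, ?_⟩
  · have hrange : Set.range (x ∘ Equiv.swap i j) = Set.range x :=
      (Equiv.swap i j).surjective.range_comp x
    by_cases hx : N.IsBase (Set.range x)
    · rw [hφ1 x hx, hφ1 _ (hrange.symm ▸ hx), hrange, hε x i j hij, mul_neg]
    · rw [hφ0 x hx, hφ0 _ (hrange.symm ▸ hx), Hyperfield.neg_zero']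
  · rw [hφ1 x hx]
    exact mul_ne_zero (hg _ hx).ne_zero (hε0 x (injective_of_ncard_range (hr _ hx)))
  · by_contra hh
    exact hx (hφ0 x hh)
  · intro z p q X hB hX hXs hXq
    have hx : Function.Injective (Fin.cons p z : Fin (n + 1) → E) := by
      refine injective_of_ncard_range ?_
      rw [Fin.range_cons]
      exact hr _ hB
    have hq : q ∉ Set.range (Fin.cons p z : Fin (n + 1) → E) := by
      rw [Fin.range_cons]
      intro hq
      rw [Set.insert_eq_of_mem hq] at hXs
      exact (h.isCircuit hX).not_indep (hB.indep.subset hXs)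
    rw [← Fin.range_cons] at hB hXs
    have hup : Function.update (Fin.cons p z : Fin (n + 1) → E) 0 q = Fin.cons q z :=
      Fin.update_cons_zero _ _ _
    have hr' := range_update hx 0 q
    rw [hup, Fin.cons_zero] at hr'
    have hp : p ∈ Set.range (Fin.cons p z : Fin (n + 1) → E) := ⟨0, rfl⟩
    -- If `X p = 0`, exchanging `p` for `q` does not give a base and both sides vanish.
    by_cases hXp : X p = 0
    · have hnot : ¬ N.IsBase (Set.range (Fin.cons q z : Fin (n + 1) → E)) := fun hh => by
        rw [hr'] at hh
        exact h.apply_ne_zero hB hp hq hh hX hXs hXp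
      rw [hφ0 _ hnot, hXp, mul_zero, zero_mul, Hyperfield.neg_zero']
    · have hpq : p ≠ q := fun hh => hq (hh ▸ hp)
      have hB' := (h.isCircuit hX).isBase_exch hB hXs hXp hpq
      have hw := h.weight_eq hε hx hB 0 hq hX hXs
      have hgq := hgw _ p q hB hp hq hB'
      rw [← hr'] at hgq hB'
      rw [hup, Fin.cons_zero] at hw
      rw [hφ1 _ hB', hφ1 _ hB, hgq, hw]
      have hinj : Function.Injective (Fin.cons q z : Fin (n + 1) → E) :=
        injective_of_ncard_range (hr _ hB')
      calc X q * (g (Set.range (Fin.cons p z)) * (-(X p / X q) *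
            (ε (Fin.cons p z) * ε (Fin.cons q z))) * ε (Fin.cons q z))
          = -((X p / X q * X q) * (g (Set.range (Fin.cons p z)) * ε (Fin.cons p z)) *
            (ε (Fin.cons q z) * ε (Fin.cons q z))) := by
            simp only [neg_mul, mul_neg]
            congr 1
            ac_rfl
        _ = _ := by rw [hε1 _ hinj, mul_one, div_mul_cancel₀ _ hXq]

/-- The vector `circVec φ x` is proportional to the circuit contained in the entries of `x`. -/
lemma circVec_eq_smul (h : M.IsUnderlying N) (hφ : IsAlternating φ)
    (hbase : ∀ x, N.IsBase (Set.range x) ↔ φ x ≠ 0) (hK : Compatible M N φ)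
    {x : Fin (n + 1 + 1) → E} (hx : Function.Injective x) {k₀ : Fin (n + 1 + 1)}
    (hk₀ : φ (x ∘ k₀.succAbove) ≠ 0) :
    ∃ X ∈ M.circuits, ∃ c : F, c ≠ 0 ∧ circVec φ x = fun e => c * X e := by
  have hB := (hbase _).2 hk₀
  have hk : x k₀ ∉ Set.range (x ∘ k₀.succAbove) := by
    rintro ⟨j, hj⟩
    exact Fin.succAbove_ne k₀ j (hx hj)
  obtain ⟨X, hX, hXs, hX0⟩ := h.exists_vector hB hk
  have h0 : circVec φ x (x k₀) ≠ 0 := by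
    rw [circVec_apply φ hx]
    exact mul_ne_zero (Hyperfield.neg_one_pow_ne_zero _) hk₀
  have hr : insert (x k₀) (Set.range (x ∘ k₀.succAbove)) = Set.range x := by
    rw [range_comp_succAbove hx, Set.insert_sdiff_singleton,
      Set.insert_eq_of_mem (Set.mem_range_self k₀)]
  refine ⟨X, hX, circVec φ x (x k₀) / X (x k₀), div_ne_zero h0 hX0, funext fun e => ?_⟩
  by_cases he : e ∈ Set.range x
  swap
  · rw [circVec_of_notMem φ he]
    have : X e = 0 := by
      by_contra hne
      exact he (hr ▸ hXs hne)
    rw [this, mul_zero]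
  obtain ⟨k, rfl⟩ := he
  rw [eq_comm, div_mul_eq_mul_div, div_eq_iff hX0]
  by_cases hkk : k = k₀
  · rw [hkk]
  obtain ⟨j, rfl⟩ := Fin.exists_succAbove_eq hkk
  rw [circVec_apply φ hx, circVec_apply φ hx]
  -- Deleting the entries `k₀` and `k` in either order leaves the same tuple. With the other entry
  -- brought to the front, the two values of `φ` are related by compatibility, up to signs that
  -- differ by `-1`.
  have e1 := hφ.map_cons_succAbove (x ∘ k₀.succAbove) j
  have e2 := hφ.map_cons_succAbove (x ∘ (k₀.succAbove j).succAbove) (j.predAbove k₀)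
  have ez : (x ∘ (k₀.succAbove j).succAbove) ∘ (j.predAbove k₀).succAbove =
      (x ∘ k₀.succAbove) ∘ j.succAbove := by
    funext i
    exact congrArg x (Fin.succAbove_succAbove_succAbove_predAbove k₀ j i)
  rw [ez, Function.comp_apply, Fin.succAbove_succAbove_predAbove] at e2
  rw [Function.comp_apply] at e1
  have hz : Set.range (x ∘ k₀.succAbove) =
      insert (x (k₀.succAbove j)) (Set.range ((x ∘ k₀.succAbove) ∘ j.succAbove)) := by
    rw [range_comp_succAbove (hx.comp Fin.succAbove_right_injective), Function.comp_apply,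
      Set.insert_sdiff_singleton,
      Set.insert_eq_of_mem (show x (k₀.succAbove j) ∈ Set.range (x ∘ k₀.succAbove) from ⟨j, rfl⟩)]
  have hk1 := hK ((x ∘ k₀.succAbove) ∘ j.succAbove) (x (k₀.succAbove j)) (x k₀) X (hz ▸ hB) hX
    (hz ▸ hXs) hX0
  have hs := Fin.neg_one_pow_succAbove_add_predAbove (R := F) k₀ j
  rw [e1, e2]
  set a := φ (Fin.cons (x (k₀.succAbove j)) ((x ∘ k₀.succAbove) ∘ j.succAbove))
  set b := φ (Fin.cons (x k₀) ((x ∘ k₀.succAbove) ∘ j.succAbove))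
  calc (-1) ^ (k₀ : ℕ) * ((-1) ^ (j : ℕ) * a) * X (x (k₀.succAbove j))
      = (-1) ^ ((k₀ : ℕ) + j) * (X (x (k₀.succAbove j)) * a) := by
        rw [pow_add]
        ac_rfl
    _ = -(-1) ^ ((k₀ : ℕ) + j) * (X (x k₀) * b) := by rw [hk1, neg_mul_neg]
    _ = _ := by
        rw [← hs, pow_add]
        ac_rfl

open HSet in
/-- Circuits are orthogonal to the vectors `e ↦ φ (e, y)`. -/
lemma perp_coVec [Fintype E] (h : M.IsUnderlying N) (hr : ∀ B, N.IsBase B → B.ncard = n + 1)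
    (hbase : ∀ x, N.IsBase (Set.range x) ↔ φ x ≠ 0) (hK : Compatible M N φ)
    {X : E → F} (hX : X ∈ M.circuits) (y : Fin n → E) : Perp X (coVec φ y) := by
  by_cases hall : ∀ e, X e * coVec φ y e = 0
  · exact perp_of_mul_eq_zero hall
  push Not at hall
  obtain ⟨f₀, hf₀⟩ := hall
  have hXf₀ : X f₀ ≠ 0 := left_ne_zero_of_mul hf₀
  have hVf₀ : φ (Fin.cons f₀ y) ≠ 0 := right_ne_zero_of_mul hf₀
  have hsub : ∀ X : Set E, X ⊆ N.E := fun X => by rw [h.1]; exact Set.subset_univ X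
  have hB : N.IsBase (insert f₀ (Set.range y)) := by
    rw [← Fin.range_cons]
    exact (hbase _).2 hVf₀
  have hyV : ∀ e ∈ Set.range y, coVec φ y e = 0 := fun e he => by
    by_contra hne
    have h1 := hr _ ((hbase _).2 hne)
    rw [Fin.range_cons, Set.insert_eq_of_mem he] at h1
    have h2 := Set.ncard_image_le (f := y) (s := Set.univ) (Set.toFinite _)
    rw [Set.image_univ, Set.ncard_univ, Nat.card_eq_fintype_card, Fintype.card_fin] at h2
    omega
  -- The element `f₀` with a nonzero term completes `y` to a base `B`, and `X` has an element `f₁`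
  -- outside `B`. All other elements of `X` outside `B` are eliminated with their fundamental
  -- circuits over `B`, leaving `Z` on `B ∪ {f₁}`.
  obtain ⟨B, hBdef⟩ : ∃ B, B = insert f₀ (Set.range y) := ⟨_, rfl⟩
  rw [← hBdef] at hB
  obtain ⟨f₁, hf₁, hf₁B⟩ : ∃ f₁ ∈ Function.support X, f₁ ∉ B :=
    Set.not_subset.1 fun hh => (h.isCircuit hX).not_indep (hB.indep.subset hh)
  obtain ⟨k, hk⟩ : ∃ k, (Function.support X \ insert f₁ B).ncard = k := ⟨_, rfl⟩
  obtain ⟨e, heinj, herange⟩ := exists_injective_range_eq hk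
  have hmem : ∀ i, X (e i) ≠ 0 ∧ e i ≠ f₁ ∧ e i ∉ B := fun i => by
    have : e i ∈ Function.support X \ insert f₁ B := herange ▸ ⟨i, rfl⟩
    exact ⟨this.1, fun hh => this.2 (Or.inl hh), fun hh => this.2 (Or.inr hh)⟩
  have hYex : ∀ i, ∃ Y ∈ M.circuits, Function.support Y ⊆ insert (e i) B ∧
      X (e i) = -Y (e i) := fun i => by
    obtain ⟨Y, hY, hYs, hYe⟩ := h.exists_vector hB (hmem i).2.2
    have hα : -(X (e i) / Y (e i)) ≠ 0 :=
      Hyperfield.neg_eq_zero'.not.2 (div_ne_zero (hmem i).1 hYe)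
    refine ⟨_, M.smul_mem Y hY _ hα, ?_, ?_⟩
    · rwa [support_smul hα]
    · rw [neg_mul, neg_neg, div_mul_cancel₀ _ hYe]
  choose Y hY hYs hYe using hYex
  have hYe0 : ∀ i, Y i (e i) ≠ 0 := fun i hh => (hmem i).1 (by rw [hYe, hh, Hyperfield.neg_zero'])
  have hYj : ∀ i j, j ≠ i → e i ∉ Function.support (Y j) := fun i j hij hh =>
    (hYs j hh).elim (fun h' => hij (heinj h').symm) (hmem i).2.2
  have hYf₁ : ∀ i, Y i f₁ = 0 := fun i => by
    by_contra hh
    exact (hYs i hh).elim (fun h' => (hmem i).2.1 h'.symm) hf₁B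
  obtain ⟨U, hU⟩ : ∃ U, U = ⋃ i, (Fin.cons (Function.support X)
    (fun i => Function.support (Y i)) : Fin (k + 1) → Set E) i := ⟨_, rfl⟩
  have hmU : ∀ f, f ∈ U ↔ X f ≠ 0 ∨ ∃ i, Y i f ≠ 0 := fun f => by
    rw [hU]
    exact iUnion_cons_support
  have hUB : U \ B = insert f₁ (Set.range e) := by
    ext f
    constructor
    · rintro ⟨hfU, hfB⟩
      rcases (hmU f).1 hfU with hf | ⟨i, hf⟩
      · by_cases hff : f = f₁
        · exact Or.inl hff
        · rw [herange]
          exact Or.inr ⟨hf, fun hh => hh.elim hff hfB⟩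
      · exact Or.inr ⟨i, ((hYs i hf).resolve_right hfB).symm⟩
    · rintro (rfl | ⟨i, rfl⟩)
      · exact ⟨(hmU _).2 (Or.inl hf₁), hf₁B⟩
      · exact ⟨(hmU _).2 (Or.inl (hmem i).1), (hmem i).2.2⟩
  have hecl : ∀ i, e i ∈ N.closure (U ∩ B) := fun i => by
    refine N.closure_subset_closure ?_
      ((h.isCircuit (hY i)).mem_closure_sdiff_singleton_of_mem (hYe0 i))
    rintro g ⟨hg, hge⟩
    exact ⟨(hmU g).2 (Or.inr ⟨i, hg⟩), (hYs i hg).resolve_left hge⟩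
  have hUBcl : U ∩ B ⊆ N.closure (U ∩ B) := N.subset_closure _ (hsub _)
  -- The complement of this basis in `U` consists of `f₁` and the `k` elements `e i`, so the nullity
  -- is `k + 1` and the family is modular.
  have hI : N.IsBasis (U ∩ B) U := by
    refine (hB.indep.subset Set.inter_subset_right).isBasis_of_subset_of_subset_closure
      Set.inter_subset_left fun f hf => ?_
    by_cases hfB : f ∈ B
    · exact hUBcl ⟨hf, hfB⟩
    have : f ∈ insert f₁ (Set.range e) := hUB ▸ ⟨hf, hfB⟩
    rcases this with rfl | ⟨i, rfl⟩
    · refine N.closure_subset_closure_of_subset_closure ?_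
        ((h.isCircuit hX).mem_closure_sdiff_singleton_of_mem hf₁)
      rintro g ⟨hg, hgf⟩
      have hgU : g ∈ U := (hmU g).2 (Or.inl hg)
      by_cases hgB : g ∈ B
      · exact hUBcl ⟨hgU, hgB⟩
      have : g ∈ insert f (Set.range e) := hUB ▸ ⟨hgU, hgB⟩
      obtain ⟨i, rfl⟩ := this.resolve_left hgf
      exact hecl i
    · exact hecl i
  have hmod : IsModularFamily (supports M.circuits)
      (Fin.cons (Function.support X) (fun i => Function.support (Y i)) : Fin (k + 1) → Set E) := by
    refine (isModularFamily_iff h.1 h.2 (hU ▸ hI)).2 ⟨?_, ?_, ?_⟩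
    · refine Fin.cons_injective_iff.2 ⟨fun hh => ?_, fun i j hij => ?_⟩
      · obtain ⟨i, hi⟩ := Set.mem_range.1 hh
        have : f₁ ∈ Function.support (Y i) := by
          rw [hi]
          exact hf₁
        exact this (hYf₁ i)
      · by_contra hne
        have : e i ∈ Function.support (Y j) := by
          rw [← show Function.support (Y i) = Function.support (Y j) from hij]
          exact hYe0 i
        exact hYj i j (Ne.symm hne) this
    · exact fun i => Fin.cases ⟨X, hX, rfl⟩ (fun i => ⟨Y i, hY i, rfl⟩) i
    · rw [← hU, Set.sdiff_self_inter, hUB, Set.ncard_insert_of_notMem,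
        ncard_range_of_injective heinj]
      rintro ⟨i, hi⟩
      exact (hmem i).2.1 hi
  obtain ⟨Z, hZ, hZe, hZf⟩ := M.elimination k X Y e hX hY hmod
    (fun hh => by
      obtain ⟨i, hi⟩ := Set.mem_iUnion.1 (hh hf₁)
      exact hi (hYf₁ i))
    hYj fun i => ⟨hYe i, (hmem i).1, hYe0 i⟩
  simp only [mem_hsum_cons_ofFn_iff] at hZf
  have hZf₁ : Z f₁ = X f₁ := by
    have := hZf f₁
    simpa only [hYf₁, single_zero, Finset.sum_const_zero, add_zero, mem_single] using this
  have hZs : Function.support Z ⊆ insert f₁ B := by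
    intro f hf
    by_contra hcon
    have hfB : f ∉ B := fun hh => hcon (Or.inr hh)
    by_cases hfU : f ∈ U
    · have : f ∈ insert f₁ (Set.range e) := hUB ▸ ⟨hfU, hfB⟩
      rcases this with hh | ⟨i, rfl⟩
      · exact hcon (Or.inl hh)
      · exact hf (hZe i)
    · rw [hmU, not_or, not_exists] at hfU
      have := hZf f
      simp only [not_not.1 hfU.1, not_not.1 (hfU.2 _), single_zero, Finset.sum_const_zero, add_zero]
        at this
      exact hf this
  subst hBdef
  have kZ : Z f₁ * coVec φ y f₁ = -(Z f₀ * coVec φ y f₀) :=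
    hK y f₀ f₁ Z hB hZ hZs (by rw [hZf₁]; exact hf₁)
  have kY : ∀ i, Y i (e i) * coVec φ y (e i) = -(Y i f₀ * coVec φ y f₀) := fun i =>
    hK y f₀ (e i) (Y i) hB (hY i) (hYs i) (hYe0 i)
  have kY' : ∀ i, coVec φ y f₀ * Y i f₀ = X (e i) * coVec φ y (e i) := fun i => by
    rw [hYe i, neg_mul, kY i, neg_neg, mul_comm]
  -- The hypersum condition at `f₀`, multiplied by the covector's value there. Compatibility
  -- rewrites the terms of `Z` and `Y i` as terms of `X` at `f₁` and `e i`, and the result is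
  -- orthogonality.
  have key := hZf f₀
  rw [← mul_mem_scale_iff (show coVec φ y f₀ ≠ 0 from hVf₀), map_add, scale_sum, scale_single,
    mul_comm _ (Z f₀), ← neg_neg (Z f₀ * coVec φ y f₀), ← kZ, ← zero_mem_single_add, hZf₁] at key
  simp only [kY'] at key
  have hinj : Function.Injective (Fin.cons f₁ (Fin.cons f₀ e) : Fin (k + 1 + 1) → E) := by
    refine Fin.cons_injective_iff.2 ⟨?_, Fin.cons_injective_iff.2 ⟨?_, heinj⟩⟩
    · rw [Fin.range_cons]
      rintro (hh | ⟨i, hi⟩)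
      · exact hf₁B (Or.inl hh)
      · exact (hmem i).2.1 hi
    · rintro ⟨i, hi⟩
      exact (hmem i).2.2 (Or.inl hi)
  unfold Perp
  rw [sum_single_eq_of_injective (X := fun g => X g * coVec φ y g) hinj fun g hg => ?_,
    Fin.sum_univ_succ, Fin.sum_univ_succ]
  · simp only [Fin.cons_succ, Fin.cons_zero]
    rwa [mul_comm (X f₀)]
  · rw [Fin.range_cons, Fin.range_cons, herange] at hg
    by_cases hXg : X g = 0
    · rw [hXg, zero_mul]
    · have h1 : g ≠ f₁ := fun hh => hg (Or.inl hh)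
      have h0 : g ≠ f₀ := fun hh => hg (Or.inr (Or.inl hh))
      have : g ∈ Set.range y := by
        by_contra hgy
        exact hg (Or.inr (Or.inr ⟨hXg, fun hh => hh.elim h1 fun hh => hh.elim h0 hgy⟩))
      rw [hyV g this, mul_zero]

end StrongMatroid.IsUnderlying

end Construction

/-! ### The bijection -/

section Bijection

variable {E : Type*} [Fintype E] {F : Type*} [Hyperfield F] {n : ℕ}

lemma Matroid.eRank_eq_iff_ncard {N : Matroid E} {r : ℕ} :
    N.eRank = (r : ℕ∞) ↔ ∀ B, N.IsBase B → B.ncard = r := by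
  constructor
  · intro h B hB
    rw [← hB.encard_eq_eRank, ← (Set.toFinite B).cast_ncard_eq] at h
    exact_mod_cast h
  · intro h
    obtain ⟨B, hB⟩ := N.exists_isBase
    rw [← hB.encard_eq_eRank, ← (Set.toFinite B).cast_ncard_eq, h B hB]

omit [Fintype E] in
lemma StrongMatroid.ext_circuits {M M' : StrongMatroid F E} (h : M.circuits = M'.circuits) :
    M = M' := by
  cases M
  cases M'
  cases h
  rfl

namespace StrongMatroid.IsUnderlying

variable {M : StrongMatroid F E} {N : Matroid E}

/-- Each `circVec φ x` is zero or a multiple of an F-circuit, so `perp_coVec` contains all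
Grassmann–Plücker relations. Uniqueness of vectors on a circuit shows that no further vectors arise.
-/
lemma exists_gpFunction [Nonempty E] (h : M.IsUnderlying N)
    (hr : ∀ B, N.IsBase B → B.ncard = n + 1) :
    ∃ φ : GPFunction F E (n + 1), GPRepresents φ.toFun N ∧
      M.circuits = GPRepresents.vectors φ.toFun N := by
  obtain ⟨φ, hφ, hbase, hK⟩ := h.exists_compatible hr
  have hperp : ∀ X ∈ M.circuits, ∀ y, Perp X (coVec φ y) :=
    fun X hX y => h.perp_coVec hr hbase hK hX y
  have hgp : ∀ x y, Function.Injective x → Perp (circVec φ x) (coVec φ y) := by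
    intro x y hx
    by_cases hall : ∀ k : Fin (n + 1 + 1), φ (x ∘ k.succAbove) = 0
    · refine perp_of_mul_eq_zero fun e => ?_
      by_cases he : e ∈ Set.range x
      · obtain ⟨k, rfl⟩ := he
        rw [circVec_apply φ hx, hall, mul_zero, zero_mul]
      · rw [circVec_of_notMem φ he, zero_mul]
    · push Not at hall
      obtain ⟨k₀, hk₀⟩ := hall
      obtain ⟨X, hX, c, hc, hXc⟩ := h.circVec_eq_smul hφ hbase hK hx hk₀
      rw [hXc]
      exact (hperp X hX y).smul hc
  obtain ⟨B, hB⟩ := N.exists_isBase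
  obtain ⟨x₀, -, hx₀⟩ := exists_injective_range_eq (hr B hB)
  let ψ : GPFunction F E (n + 1) :=
    { toFun := φ
      not_identically_zero := ⟨x₀, (hbase x₀).1 (hx₀ ▸ hB)⟩
      map_swap := hφ
      map_eq_zero := fun x i j hij hx => by
        by_contra hne
        exact hij (injective_of_ncard_range (hr _ ((hbase x).2 hne)) hx)
      grassmann_pluecker := fun x y hx _ => (perp_circVec_coVec_iff φ hx y).2 (hgp x y hx) }
  have hrep : GPRepresents φ N := ⟨h.1, hbase, hr, hgp⟩
  refine ⟨ψ, hrep, Set.Subset.antisymm (fun X hX => ⟨h.isCircuit hX, hperp X hX⟩) ?_⟩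
  intro X hX
  obtain ⟨X', hX', hs⟩ := h.exists_mem hX.1
  obtain ⟨α, hα, hXα⟩ := hrep.eq_smul_of_perp hX.1 hs hX.2 (hperp X' hX')
  rw [show X = fun e => α * X' e from funext hXα]
  exact M.smul_mem X' hX' α hα

end StrongMatroid.IsUnderlying

lemma GPRepresents.isUnderlying {φ : (Fin (n + 1) → E) → F} {N : Matroid E}
    (h : GPRepresents φ N) : h.strongMatroid.IsUnderlying N :=
  ⟨h.ground_eq, h.isCircuit_iff⟩

lemma GPRepresents.mul_coVec_eq {φ : (Fin (n + 1) → E) → F} {N : Matroid E}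
    (h : GPRepresents φ N) {X : E → F} (hX : X ∈ vectors φ N) {y : Fin n → E} {p q : E}
    (hpq : p ≠ q) (hXs : Function.support X ⊆ insert q (insert p (Set.range y))) :
    X q * coVec φ y q = -(X p * coVec φ y p) := by
  refine (hX.2 y).pair hpq fun e hep heq => ?_
  by_cases hXe : X e = 0
  · rw [hXe, zero_mul]
  · rw [h.coVec_eq_zero_of_mem (((hXs hXe).resolve_left heq).resolve_left hep), mul_zero]

/-- Two Grassmann–Plücker functions with the same circuit vectors are equivalent. -/
lemma GPFunction.equiv_of_vectors_eq {φ ψ : GPFunction F E (n + 1)} {N : Matroid E}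
    (hφ : GPRepresents φ.toFun N) (hψ : GPRepresents ψ.toFun N)
    (hv : GPRepresents.vectors φ.toFun N = GPRepresents.vectors ψ.toFun N) : φ ≈ ψ := by
  obtain ⟨x₀, hx₀⟩ := φ.not_identically_zero
  have hB₀ := (hφ.isBase_range_iff x₀).2 hx₀
  have hψ₀ := (hψ.isBase_range_iff x₀).1 hB₀
  set α := φ.toFun x₀ / ψ.toFun x₀ with hα
  have hα0 : α ≠ 0 := div_ne_zero hx₀ hψ₀
  have hperm : ∀ x x' : Fin (n + 1) → E, N.IsBase (Set.range x) → Set.range x' = Set.range x →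
      φ.toFun x = α * ψ.toFun x → φ.toFun x' = α * ψ.toFun x' := by
    intro x x' hx hxx heq
    obtain ⟨σ, rfl⟩ := exists_perm_of_range_eq (injective_of_ncard_range (hφ.ncard_eq _ hx)) hxx
    rw [IsAlternating.map_perm φ.map_swap, IsAlternating.map_perm ψ.map_swap, heq, mul_left_comm]
  -- Induction on the distance from the base of `x₀`. Each exchange towards it has a ratio fixed by
  -- a common circuit vector, so `α` propagates from one base to the next.
  have key : ∀ m : ℕ, ∀ x : Fin (n + 1) → E, N.IsBase (Set.range x) →
      (Set.range x \ Set.range x₀).ncard = m → φ.toFun x = α * ψ.toFun x := by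
    intro m
    induction m with
    | zero =>
      intro x hx hm
      rw [Set.ncard_eq_zero, Set.sdiff_eq_empty] at hm
      refine hperm x₀ x hB₀ (hx.eq_of_subset_isBase hB₀ hm) ?_
      rw [hα, div_mul_cancel₀ _ hψ₀]
    | succ m ih =>
      intro x hx hm
      obtain ⟨p, hp, hp₀⟩ : (Set.range x \ Set.range x₀).Nonempty := by
        rw [← Set.ncard_pos]
        omega
      obtain ⟨q, ⟨hq₀, hq⟩, hB'⟩ := hx.exchange hB₀ ⟨hp, hp₀⟩
      have hB' : N.IsBase (exch (Set.range x) p q) := hB'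
      have hpq : p ≠ q := fun hh => hq (hh ▸ hp)
      have hcard := ncard_exch_sdiff (b := Set.range x₀) hp hq
      rw [if_neg hp₀, if_pos hq₀] at hcard
      obtain ⟨y, hy⟩ := hφ.exists_range_eq hx hp
      have hyp : insert p (Set.range y) = Set.range x := by
        rw [hy, Set.insert_sdiff_singleton, Set.insert_eq_of_mem hp]
      have hyq : Set.range (Fin.cons q y : Fin (n + 1) → E) = exch (Set.range x) p q := by
        rw [Fin.range_cons, hy]
        rfl
      have hq' : φ.toFun (Fin.cons q y) = α * ψ.toFun (Fin.cons q y) := by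
        refine ih _ (hyq ▸ hB') ?_
        rw [hyq]
        omega
      obtain ⟨C, hC, hCs, hpC, -⟩ := exists_isCircuit_of_isBase_exch hx hp hq hB'
      obtain ⟨X, hX, rfl⟩ := (hφ.isCircuit_iff C).1 hC
      rw [← hyp] at hCs
      have h1 := hφ.mul_coVec_eq hX hpq hCs
      have h2 := hψ.mul_coVec_eq (hv ▸ hX) hpq hCs
      have hp' : φ.toFun (Fin.cons p y) = α * ψ.toFun (Fin.cons p y) := by
        apply mul_left_cancel₀ (show X p ≠ 0 from hpC)
        rw [coVec, coVec] at h1 h2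
        rw [← neg_neg (X p * φ.toFun _), ← h1, hq', mul_left_comm, h2, mul_neg, neg_neg,
          mul_left_comm]
      refine hperm (Fin.cons p y) x ?_ ?_ hp'
      · rwa [Fin.range_cons, hyp]
      · rw [Fin.range_cons, hyp]
  refine ⟨α, hα0, fun x => ?_⟩
  by_cases hx : N.IsBase (Set.range x)
  · exact key _ x hx rfl
  · have h1 := (hφ.isBase_range_iff x).not.1 hx
    have h2 := (hψ.isBase_range_iff x).not.1 hx
    rw [not_not.1 h1, not_not.1 h2, mul_zero]

/-- The underlying matroid of a Grassmann–Plücker function. -/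
noncomputable def GPFunction.matroid (φ : GPFunction F E (n + 1)) : Matroid E :=
  φ.exists_matroid.choose

lemma GPFunction.gpRepresents (φ : GPFunction F E (n + 1)) : GPRepresents φ.toFun φ.matroid :=
  φ.exists_matroid.choose_spec.1

lemma GPFunction.isBase_iff (φ : GPFunction F E (n + 1)) (B : Set E) :
    φ.matroid.IsBase B ↔ B ∈ φ.baseSets :=
  φ.exists_matroid.choose_spec.2 B

lemma GPFunction.matroid_unique (φ : GPFunction F E (n + 1)) {N : Matroid E}
    (h : GPRepresents φ.toFun N) : N = φ.matroid := by
  refine Matroid.ext_isBase (h.ground_eq.trans φ.gpRepresents.ground_eq.symm) fun B _ => ?_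
  constructor
  · intro hB
    obtain ⟨x, -, rfl⟩ := exists_injective_range_eq (h.ncard_eq B hB)
    rwa [φ.gpRepresents.isBase_range_iff, ← h.isBase_range_iff]
  · intro hB
    obtain ⟨x, -, rfl⟩ := exists_injective_range_eq (φ.gpRepresents.ncard_eq B hB)
    rwa [h.isBase_range_iff, ← φ.gpRepresents.isBase_range_iff]

/-- The strong matroid of a Grassmann–Plücker function, with its rank. -/
noncomputable def GPFunction.toStrongMatroid (φ : GPFunction F E (n + 1)) :
    {M : StrongMatroid F E // M.HasRank (n + 1)} :=
  ⟨φ.gpRepresents.strongMatroid, φ.matroid, φ.gpRepresents.isUnderlying,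
    Matroid.eRank_eq_iff_ncard.2 φ.gpRepresents.ncard_eq⟩

lemma perp_smul_right {X Y : E → F} {α : F} (hα : α ≠ 0) (h : Perp X Y) :
    Perp X (fun e => α * Y e) := by
  have := h.smul hα
  unfold Perp at this ⊢
  simpa only [mul_left_comm, mul_assoc] using this

lemma GPFunction.toStrongMatroid_eq {φ ψ : GPFunction F E (n + 1)} (h : φ ≈ ψ) :
    φ.toStrongMatroid = ψ.toStrongMatroid := by
  have hrep : ∀ {φ ψ : GPFunction F E (n + 1)}, φ ≈ ψ → φ.matroid = ψ.matroid ∧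
      GPRepresents.vectors φ.toFun φ.matroid ⊆ GPRepresents.vectors ψ.toFun ψ.matroid := by
    rintro φ ψ ⟨α, hα, hφψ⟩
    have hN : φ.matroid = ψ.matroid := by
      refine ψ.matroid_unique ⟨φ.gpRepresents.ground_eq, fun x => ?_, φ.gpRepresents.ncard_eq,
        fun x y hx => ψ.perp hx y⟩
      rw [φ.gpRepresents.isBase_range_iff, hφψ, mul_ne_zero_iff, and_iff_right hα]
    refine ⟨hN, fun X hX => ⟨hN ▸ hX.1, fun y => ?_⟩⟩
    have := perp_smul_right (inv_ne_zero hα) (hX.2 y)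
    simp only [coVec, hφψ, inv_mul_cancel_left₀ hα] at this
    exact this
  refine Subtype.ext (StrongMatroid.ext_circuits ?_)
  exact Set.Subset.antisymm (hrep h).2 (hrep (Setoid.symm h)).2

/-- Equivalence classes of Grassmann–Plücker functions of rank `n + 1` correspond to strong
matroids of rank `n + 1`. -/
noncomputable def gpEquiv [Nonempty E] :
    GPClass F E (n + 1) ≃ {M : StrongMatroid F E // M.HasRank (n + 1)} :=
  Equiv.ofBijective
    (Quotient.lift GPFunction.toStrongMatroid fun _ _ h => GPFunction.toStrongMatroid_eq h) <| by
    constructor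
    · rintro ⟨φ⟩ ⟨ψ⟩ h
      have hv : GPRepresents.vectors φ.toFun φ.matroid =
          GPRepresents.vectors ψ.toFun ψ.matroid :=
        congrArg (fun M : {M : StrongMatroid F E // M.HasRank (n + 1)} => M.1.circuits) h
      have hN : φ.matroid = ψ.matroid := by
        have h1 := φ.gpRepresents.isUnderlying
        have h2 := ψ.gpRepresents.isUnderlying
        have hM : φ.gpRepresents.strongMatroid = ψ.gpRepresents.strongMatroid :=
          StrongMatroid.ext_circuits hv
        rw [hM] at h1
        exact h1.unique h2
      rw [← hN] at hv
      exact Quotient.sound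
        (GPFunction.equiv_of_vectors_eq φ.gpRepresents (hN ▸ ψ.gpRepresents) hv)
    · rintro ⟨M, N, hMN, hr⟩
      obtain ⟨φ, hφ, hM⟩ := hMN.exists_gpFunction (Matroid.eRank_eq_iff_ncard.1 hr)
      refine ⟨⟦φ⟧, Subtype.ext (StrongMatroid.ext_circuits ?_)⟩
      rw [hM, φ.matroid_unique hφ]
      rfl

end Bijection

theorem theorem3p13 {F : Type*} [Hyperfield F] {E : Type*} [Finite E] [Nonempty E]
    (r : ℕ) (hr : 1 ≤ r) :
    (∀ M : StrongMatroid F E, ∃! N : Matroid E, M.IsUnderlying N) ∧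
    ∃ Φ : GPClass F E r ≃ {M : StrongMatroid F E // M.HasRank r},
      ∀ φ : GPFunction F E r, ∃ N : Matroid E,
        N.E = Set.univ ∧ N.eRank = (r : ℕ∞) ∧
        (∀ B : Set E, N.IsBase B ↔ B ∈ φ.baseSets) ∧
        (Φ ⟦φ⟧).1.IsUnderlying N ∧
        (Φ ⟦φ⟧).1.circuits = φ.circuitVectors N := by
  cases nonempty_fintype E
  obtain ⟨n, rfl⟩ : ∃ n, r = n + 1 := ⟨r - 1, by omega⟩
  refine ⟨fun M => ?_, gpEquiv, fun φ => ⟨φ.matroid, φ.gpRepresents.ground_eq,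
    Matroid.eRank_eq_iff_ncard.2 φ.gpRepresents.ncard_eq, φ.isBase_iff,
    φ.gpRepresents.isUnderlying, (φ.circuitVectors_eq φ.gpRepresents).symm⟩⟩
  obtain ⟨N, hN⟩ := M.exists_isUnderlying
  exact ⟨N, hN, fun N' hN' => hN'.unique hN⟩
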